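/- **Setting.** Let $I$ be the (finite) vertex set of a bipartite simple graph, $I=I_{\bar 0}\sqcup I_{\bar 1}$ (even and odd vertices). Write $i\sim j$ if $i,j$ are connected, and $i\to j$ (or $j\leftarrow i$) if $i\sim j$, $i$ is even and $j$ is odd. Put $\alpha_i\cdot\alpha_i=2$, $\alpha_i\cdot\alpha_j=-1$ if $i\sim j$, and $\alpha_i\cdot\alpha_j=0$ otherwise. Let $\lambda=\sum_i\lambda_i\varpi_i$ be a dominant weight and $\mu$ a weight of the corresponding derived simply-laced Kac–Moody algebra, with $\lambda-\mu=\sum_i m_i\alpha_i$, $m_i\in\mathbb Z_{\ge 0}$, that is, $\lambda_i-\langle\mu,\alpha_i^\vee\rangle=\sum_j m_j\,\alpha_i\cdot\alpha_j$ for all $i$. Let $\mathbf R=(R_i)_{i\in I}$, where $R_i$ is a multiset of $\lambda_i$ complex numbers, and let $p_i(u)=\prod_{c\in R_i}(u-c)$. The shifted Yangian $Y_\mu=Y_\mu(\mathbf R)$ is the $\mathbb C$-algebra with generators $A_i^{(q)},E_i^{(q)},F_i^{(q)}$ ($i\in I$, $q>0$), with $A_i^{(0)}=1$, and relations \begin{align*}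 [A_i^{(p)},A_j^{(q)}]&=0,\\ [E_i^{(p)},F_j^{(q)}]&=2\delta_{ij}H_i^{(p+q-1)},\\ [A_i^{(p+1)},E_j^{(q)}]-[A_i^{(p)},E_j^{(q+1)}]&=-2\delta_{ij}A_i^{(p)}E_j^{(q)}\quad(p\ge 0),\\ [A_i^{(p+1)},F_j^{(q)}]-[A_i^{(p)},F_j^{(q+1)}]&=2\delta_{ij}F_j^{(q)}A_i^{(p)}\quad(p\ge 0),\\ [E_i^{(p+1)},E_j^{(q)}]-[E_i^{(p)},E_j^{(q+1)}]&=\alpha_i\cdot\alpha_j\,(E_i^{(p)}E_j^{(q)}+E_j^{(q)}E_i^{(p)}),\\ [F_i^{(p+1)},F_j^{(q)}]-[F_i^{(p)},F_j^{(q+1)}]&=-\alpha_i\cdot\alpha_j\,(F_i^{(p)}F_j^{(q)}+F_j^{(q)}F_i^{(p)}), \end{align*} and, for $i\ne j$ and $N=1-\alpha_i\cdot\alpha_j$, the Serre relations $$\operatorname{sym}[E_i^{(p_1)},[E_i^{(p_2)},\cdots[E_i^{(p_N)},E_j^{(q)}]\cdots]]=0,\qquad \operatorname{sym}[F_i^{(p_1)},[F_i^{(p_2)},\cdots[F_i^{(p_N)},F_j^{(q)}]\cdots]]=0,$$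 where $\operatorname{sym}$ is the sum over all permutations of $p_1,\dots,p_N$. Here $A_i(u)=\sum_{p\ge 0}A_i^{(p)}u^{-p}$, and $H_i^{(q)}$ ($q\in\mathbb Z$) is the coefficient of $u^{-q}$ in the expansion in $u^{-1}$ of $$H_i(u)=p_i(u)\,\frac{\prod_{j\sim i}(u-1)^{m_j}}{u^{m_i}(u-2)^{m_i}}\,\frac{\prod_{j\sim i}A_j(u-1)}{A_i(u)A_i(u-2)}.$$ Let $E_i(u)=\sum_{q>0}E_i^{(q)}u^{-q}$ and $F_i(u)=\sum_{q>0}F_i^{(q)}u^{-q}$. Let $P=\mathbb C[z_{i,r}: i\in I,\ 1\le r\le m_i]$, and let $P^\Sigma$ be its subalgebra of invariants under $\Sigma=\prod_i\Sigma_{m_i}$, where $\Sigma_{m_i}$ permutes the variables $z_{i,1},\dots,z_{i,m_i}$. Let $W_i(u)=\prod_r(u-z_{i,r})$ and $W_{i,r}(u)=\prod_{s\ne r}(u-z_{i,s})$, and let $\beta_{i,r}$ be the automorphism of $P$ with $\beta_{i,r}(z_{j,s})=z_{j,s}+2\delta_{ij}\delta_{rs}$. **Theorem.** (1) There is a unique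 action of $Y_\mu$ on $P^\Sigma$ (a homomorphism of $\mathbb C$-algebras $Y_\mu\to\operatorname{End}_{\mathbb C}(P^\Sigma)$) under which, expanding in $u^{-1}$, \begin{align*} A_i(u)&\mapsto u^{-m_i}W_i(u),\\ E_i(u)&\mapsto-\sum_{r=1}^{m_i}\frac{\prod_{j\to i}W_j(z_{i,r}-1)}{(u-z_{i,r})\,W_{i,r}(z_{i,r})}\,\beta_{i,r}^{-1},\\ F_i(u)&\mapsto\sum_{r=1}^{m_i}\frac{p_i(z_{i,r}+2)\prod_{j\leftarrow i}W_j(z_{i,r}+1)}{(u-z_{i,r}-2)\,W_{i,r}(z_{i,r})}\,\beta_{i,r}. \end{align*} (2) Let $R$ be a commutative $\mathbb C$-algebra that is a domain, let $m\ge 1$ and $c(t)\in R[t]$. On $R(z_1,\dots,z_m)$ let $\beta_r$ be the $R$-algebra automorphism with $\beta_r(z_s)=z_s+2\delta_{rs}$, let $s_r$ exchange $z_r$ and $z_{r+1}$, and let $\partial_r=\frac{1}{z_{r+1}-z_r}(s_r-1)$. Then the $R$-linear endomorphisms $$\sum_{r=1}^m\frac{c(z_r)}{\prod_{s\ne r}(z_r-z_s)}\,\beta_r\qquad\text{and}\qquad\partial_{m-1}\cdots\partial_1\,c(z_1)\,\beta_1$$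 agree on $R(z_1,\dots,z_m)^{\Sigma_m}$, and both map $R[z_1,\dots,z_m]^{\Sigma_m}$ into itself. -/

import Mathlib

noncomputable section

open scoped Classical

namespace ShiftedYangian

/-- The symmetric pairing `αᵢ · αⱼ = ⟨αⱼ, αᵢ^∨⟩` of simple roots of the simply-laced Kac-Moody
algebra whose Dynkin diagram is the graph `G`. -/
def dot {I : Type*} (G : SimpleGraph I) (i j : I) : ℤ :=
  if i = j then 2 else if G.Adj i j then -1 else 0

/-- The data on which the shifted Yangian depends: a bipartite graph (`odd i` says that the vertex
`i` is odd), a dominant weight `λ = ∑ᵢ lam i • ϖᵢ`, a weight `μ = ∑ᵢ mu i • ϖᵢ` together with an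
expression `λ - μ = ∑ᵢ m i • αᵢ` with `m i ≥ 0`, and a set of parameters `R` of weight `λ`. -/
structure Datum (I : Type*) [Fintype I] where
  graph : SimpleGraph I
  odd : I → Prop
  bipartite : ∀ i j, graph.Adj i j → (odd i ↔ ¬ odd j)
  lam : I → ℕ
  mu : I → ℤ
  m : I → ℕ
  mu_eq : ∀ i, (lam i : ℤ) - mu i = ∑ j, (m j : ℤ) * dot graph i j
  R : I → Multiset ℂ
  card_R : ∀ i, (R i).card = lam i

/-! ### Laurent series in `u⁻¹` -/

/-- The variable `u`, in the ring `S((u⁻¹))` of formal Laurent series in `u⁻¹`. The coefficient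
`(s : LaurentSeries S).coeff q` is thus the coefficient of `u^{-q}`. -/
def uVar (S : Type*) [CommRing S] : LaurentSeries S := HahnSeries.single (-1) 1

/-- The series `∑_{n ≥ 0} g n u^{-n}`. -/
def genSeries {S : Type*} [CommRing S] (g : ℕ → S) : LaurentSeries S :=
  HahnSeries.ofPowerSeries ℤ S (PowerSeries.mk g)

/-- The expansion in `u⁻¹` of `∑_{p ≥ 0} g p (u - a)^{-p}`. With `w = u⁻¹` one has
`(u - a)⁻¹ = w ∑_k a^k w^k`, whose `p`-th power contributes to `w^n` only if `p ≤ n`. -/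
def genSeriesShift {S : Type*} [CommRing S] (g : ℕ → S) (a : S) : LaurentSeries S :=
  genSeries fun n => ∑ p ∈ Finset.range (n + 1),
    g p * PowerSeries.coeff n ((PowerSeries.X * PowerSeries.mk fun k => a ^ k) ^ p)

/-! ### The shifted Yangian -/

/-- The generators `Aᵢ^{(q)}`, `Eᵢ^{(q)}`, `Fᵢ^{(q)}` for `q > 0`. -/
inductive Gen (I : Type*)
  | A (i : I) (q : ℕ+)
  | E (i : I) (q : ℕ+)
  | F (i : I) (q : ℕ+)

abbrev Free (I : Type*) := FreeAlgebra ℂ (Gen I)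

/-- `Aᵢ^{(p)}` for `p ≥ 0`, where `Aᵢ^{(0)} = 1`. -/
def genA {I : Type*} (i : I) (p : ℕ) : Free I :=
  if h : 0 < p then FreeAlgebra.ι ℂ (Gen.A i ⟨p, h⟩) else 1

def genE {I : Type*} (i : I) (q : ℕ+) : Free I := FreeAlgebra.ι ℂ (Gen.E i q)

def genF {I : Type*} (i : I) (q : ℕ+) : Free I := FreeAlgebra.ι ℂ (Gen.F i q)

/-- The commutative polynomial ring in variables `Aᵢ^{(q)}`, `q > 0`. -/
abbrev CPoly (I : Type*) := MvPolynomial (I × ℕ+) ℂ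

/-- The variable `Aᵢ^{(p)}` of the commutative polynomial ring, with `Aᵢ^{(0)} = 1`. -/
def cA {I : Type*} (i : I) (p : ℕ) : CPoly I :=
  if h : 0 < p then MvPolynomial.X (i, ⟨p, h⟩) else 1

/-- The linear map that writes a commutative polynomial in the `Aᵢ^{(q)}` as an element of the free
algebra, each monomial becoming a product of generators in some order. The `Aᵢ^{(q)}` commute in the
shifted Yangian, so the order plays no role there. -/
def ofCPoly {I : Type*} : CPoly I →ₗ[ℂ] Free I :=
  (MvPolynomial.basisMonomials (I × ℕ+) ℂ).constr ℂ fun d =>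
    ((Finsupp.toMultiset d).toList.map fun v => FreeAlgebra.ι ℂ (Gen.A v.1 v.2)).prod

namespace Datum

variable {I : Type*} [Fintype I] (D : Datum I)

/-- The vertices connected to `i`. -/
def nbrs (i : I) : Finset I := Finset.univ.filter fun j => D.graph.Adj i j

/-- Oriented edges `i → j` go from even vertices to odd vertices. -/
def Arrow (i j : I) : Prop := D.graph.Adj i j ∧ ¬ D.odd i ∧ D.odd j

/-- The polynomial `pᵢ(u) = ∏_{c ∈ Rᵢ} (u - c)`. -/
def pPoly (i : I) : Polynomial ℂ :=
  ((D.R i).map fun c => Polynomial.X - Polynomial.C c).prod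

/-- The denominator `u^{mᵢ} (u - 2)^{mᵢ} Aᵢ(u) Aᵢ(u - 2)` of `Hᵢ(u)`. -/
def hDenom (i : I) : LaurentSeries (CPoly I) :=
  uVar (CPoly I) ^ D.m i * (uVar (CPoly I) - 2) ^ D.m i
    * (genSeries (cA i) * genSeriesShift (cA i) 2)

/-- The series `Hᵢ(u) = pᵢ(u) ∏_{j ∼ i} (u-1)^{mⱼ} / (u^{mᵢ} (u-2)^{mᵢ})
· ∏_{j ∼ i} Aⱼ(u-1) / (Aᵢ(u) Aᵢ(u-2))`; the denominator is a unit by `isUnit_hDenom`. -/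
def hSeries (i : I) : LaurentSeries (CPoly I) :=
  (D.pPoly i).eval₂ (HahnSeries.C.comp MvPolynomial.C) (uVar (CPoly I))
    * (∏ j ∈ D.nbrs i, (uVar (CPoly I) - 1) ^ D.m j)
    * (∏ j ∈ D.nbrs i, genSeriesShift (cA j) 1)
    * Ring.inverse (D.hDenom i)

/-- `Hᵢ^{(q)}`, the coefficient of `u^{-q}` in `Hᵢ(u)`. -/
def genH (i : I) (q : ℤ) : Free I := ofCPoly ((D.hSeries i).coeff q)

/-- The iterated bracket `[x_1, [x_2, ⋯ [x_N, y] ⋯ ]]`. -/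
def iterBracket {B : Type*} [Ring B] (l : List B) (y : B) : B :=
  l.foldr (fun x z => ⁅x, z⁆) y

/-- The symmetrization over `p_1, …, p_N` of `[X^{(p_1)}, [X^{(p_2)}, ⋯ [X^{(p_N)}, y] ⋯ ]]`. -/
def symBracket {B : Type*} [Ring B] (X : ℕ+ → B) (y : B) {N : ℕ} (p : Fin N → ℕ+) : B :=
  ∑ s : Equiv.Perm (Fin N), iterBracket (List.ofFn fun k => X (p (s k))) y

/-- The defining relations of the shifted Yangian. -/
inductive Rel : Free I → Free I → Prop
  | AA (i j : I) (p q : ℕ) : Rel ⁅genA i p, genA j q⁆ 0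
  | EF (i j : I) (p q : ℕ+) :
      Rel ⁅genE i p, genF j q⁆ (if i = j then 2 * D.genH i ((p : ℤ) + (q : ℤ) - 1) else 0)
  | AE (i j : I) (p : ℕ) (q : ℕ+) :
      Rel (⁅genA i (p + 1), genE j q⁆ - ⁅genA i p, genE j (q + 1)⁆)
        (if i = j then -(2 * (genA i p * genE j q)) else 0)
  | AF (i j : I) (p : ℕ) (q : ℕ+) :
      Rel (⁅genA i (p + 1), genF j q⁆ - ⁅genA i p, genF j (q + 1)⁆)
        (if i = j then 2 * (genF j q * genA i p) else 0)
  | EE (i j : I) (p q : ℕ+) :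
      Rel (⁅genE i (p + 1), genE j q⁆ - ⁅genE i p, genE j (q + 1)⁆)
        (dot D.graph i j • (genE i p * genE j q + genE j q * genE i p))
  | FF (i j : I) (p q : ℕ+) :
      Rel (⁅genF i (p + 1), genF j q⁆ - ⁅genF i p, genF j (q + 1)⁆)
        (-(dot D.graph i j • (genF i p * genF j q + genF j q * genF i p)))
  | serreE (i j : I) (hij : i ≠ j) (p : Fin (1 - dot D.graph i j).toNat → ℕ+) (q : ℕ+) :
      Rel (symBracket (genE i) (genE j q) p) 0
  | serreF (i j : I) (hij : i ≠ j) (p : Fin (1 - dot D.graph i j).toNat → ℕ+) (q : ℕ+) :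
      Rel (symBracket (genF i) (genF j q) p) 0

/-- The shifted Yangian `Y_μ`. -/
abbrev Y : Type _ := RingQuot D.Rel

/-- The element `Aᵢ^{(p)}` of `Y_μ`, `p ≥ 0`, with `Aᵢ^{(0)} = 1`. -/
def A (i : I) (p : ℕ) : D.Y := RingQuot.mkAlgHom ℂ D.Rel (genA i p)

/-- The element `Eᵢ^{(q)}` of `Y_μ`, `q > 0`. -/
def E (i : I) (q : ℕ+) : D.Y := RingQuot.mkAlgHom ℂ D.Rel (genE i q)

/-- The element `Fᵢ^{(q)}` of `Y_μ`, `q > 0`. -/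
def F (i : I) (q : ℕ+) : D.Y := RingQuot.mkAlgHom ℂ D.Rel (genF i q)

end Datum

/-! ### Shift operators -/

/-- The automorphism `β_v` of a polynomial ring, with `β_v(z_w) = z_w + 2 δ_{vw}`. -/
def beta (S : Type*) [CommRing S] {τ : Type*} (v : τ) :
    MvPolynomial τ S ≃ₐ[S] MvPolynomial τ S :=
  AlgEquiv.ofAlgHom
    (MvPolynomial.aeval fun w => MvPolynomial.X w + if w = v then 2 else 0)
    (MvPolynomial.aeval fun w => MvPolynomial.X w - if w = v then 2 else 0)
    (by
      apply MvPolynomial.algHom_ext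
      intro w
      have h2 (φ : MvPolynomial τ S →ₐ[S] MvPolynomial τ S) : φ 2 = 2 := map_ofNat φ 2
      by_cases h : w = v <;> simp [h, h2, -MvPolynomial.aeval_eq_bind₁])
    (by
      apply MvPolynomial.algHom_ext
      intro w
      have h2 (φ : MvPolynomial τ S →ₐ[S] MvPolynomial τ S) : φ 2 = 2 := map_ofNat φ 2
      by_cases h : w = v <;> simp [h, h2, -MvPolynomial.aeval_eq_bind₁])

namespace Datum

variable {I : Type*} [Fintype I] (D : Datum I)

/-! ### The difference operators on symmetric polynomials -/

/-- The index set of the variables `z_{i,r}`, `i ∈ I`, `1 ≤ r ≤ mᵢ`. -/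
abbrev Var := Σ i : I, Fin (D.m i)

/-- The polynomial ring `P = ℂ[z_{i,r}]`. -/
abbrev P := MvPolynomial D.Var ℂ

/-- The subalgebra `P^Σ` of invariants of `Σ = ∏ᵢ Σ_{mᵢ}`. -/
def PSym : Subalgebra ℂ D.P :=
  ⨅ s : (i : I) → Equiv.Perm (Fin (D.m i)),
    AlgHom.equalizer (MvPolynomial.rename (Equiv.sigmaCongrRight s)) (AlgHom.id ℂ D.P)

/-- The field of Laurent series in `u⁻¹` over the fraction field of `P`. -/
abbrev L := LaurentSeries (FractionRing D.P)

/-- The variable `z_{i,r}`. -/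
def z (i : I) (r : Fin (D.m i)) : D.P := MvPolynomial.X ⟨i, r⟩

/-- The polynomial `Wᵢ(u) = ∏_r (u - z_{i,r})`. -/
def W (i : I) : Polynomial D.P := ∏ r, (Polynomial.X - Polynomial.C (D.z i r))

/-- The polynomial `W_{i,r}(u) = ∏_{s ≠ r} (u - z_{i,s})`. -/
def Wr (i : I) (r : Fin (D.m i)) : Polynomial D.P :=
  ∏ s ∈ Finset.univ.erase r, (Polynomial.X - Polynomial.C (D.z i s))

/-- An element of `P` as a constant Laurent series. -/
def ofP : D.P →+* D.L := HahnSeries.C.comp (algebraMap D.P (FractionRing D.P))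

/-- The right hand side `u^{-mᵢ} Wᵢ(u)` for `Aᵢ(u)`, applied to `f`. -/
def rhsA (i : I) (f : D.P) : D.L :=
  (uVar (FractionRing D.P)) ^ (-(D.m i : ℤ))
    * (D.W i).eval₂ D.ofP (uVar (FractionRing D.P)) * D.ofP f

/-- The right hand side
`- ∑_r ∏_{j → i} Wⱼ(z_{i,r} - 1) / ((u - z_{i,r}) W_{i,r}(z_{i,r})) β_{i,r}⁻¹`
for `Eᵢ(u)`, applied to `f`. -/
def rhsE (i : I) (f : D.P) : D.L :=
  - ∑ r : Fin (D.m i),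
    D.ofP (∏ j ∈ Finset.univ.filter (fun j => D.Arrow j i), (D.W j).eval (D.z i r - 1))
      / ((uVar (FractionRing D.P) - D.ofP (D.z i r)) * D.ofP ((D.Wr i r).eval (D.z i r)))
      * D.ofP ((beta ℂ (⟨i, r⟩ : D.Var)).symm f)

/-- The right hand side
`∑_r pᵢ(z_{i,r} + 2) ∏_{j ← i} Wⱼ(z_{i,r} + 1) / ((u - z_{i,r} - 2) W_{i,r}(z_{i,r})) β_{i,r}`
for `Fᵢ(u)`, applied to `f`. -/
def rhsF (i : I) (f : D.P) : D.L :=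
  ∑ r : Fin (D.m i),
    D.ofP (Polynomial.aeval (D.z i r + 2) (D.pPoly i)
        * ∏ j ∈ Finset.univ.filter (fun j => D.Arrow i j), (D.W j).eval (D.z i r + 1))
      / ((uVar (FractionRing D.P) - D.ofP (D.z i r) - 2) * D.ofP ((D.Wr i r).eval (D.z i r)))
      * D.ofP (beta ℂ (⟨i, r⟩ : D.Var) f)

/-- The series `∑_{p ≥ 0} g p u^{-p}` with coefficients in `P^Σ`. -/
def symSeries (g : ℕ → D.PSym) : D.L :=
  genSeries fun p => algebraMap D.P (FractionRing D.P) (g p)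

/-- The series `∑_{q > 0} g q u^{-q}` with coefficients in `P^Σ`. -/
def symSeriesPos (g : ℕ+ → D.PSym) : D.L :=
  D.symSeries fun p => if h : 0 < p then g ⟨p, h⟩ else 0

end Datum

/-! ### Operators on rational functions -/

/-- The field `S(z_1, …, z_m)`. -/
abbrev RatFun (S : Type*) [CommRing S] (m : ℕ) := FractionRing (MvPolynomial (Fin m) S)

section RatFun

variable (S : Type*) [CommRing S] [IsDomain S]

/-- The shift `β_r` of `S(z_1, …, z_m)`. -/
def ratBeta {m : ℕ} (r : Fin m) : RatFun S m ≃ₐ[S] RatFun S m :=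
  IsFractionRing.algEquivOfAlgEquiv (beta S r)

/-- The action of a permutation of the variables on `S(z_1, …, z_m)`. -/
def ratPerm {m : ℕ} (s : Equiv.Perm (Fin m)) : RatFun S m ≃ₐ[S] RatFun S m :=
  IsFractionRing.algEquivOfAlgEquiv (MvPolynomial.renameEquiv S s)

/-- The variable `z_r` in `S(z_1, …, z_m)`. -/
def ratZ {m : ℕ} (r : Fin m) : RatFun S m :=
  algebraMap (MvPolynomial (Fin m) S) (RatFun S m) (MvPolynomial.X r)

/-- The divided difference operator `(z_{r+1} - z_r)⁻¹ (s_r - 1)` on `S(z_1, …, z_{n+1})`. -/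
def divDiff {n : ℕ} (r : Fin n) : Module.End S (RatFun S (n + 1)) :=
  LinearMap.mulLeft S (ratZ S r.succ - ratZ S r.castSucc)⁻¹ *
    ((ratPerm S (Equiv.swap r.castSucc r.succ)).toLinearMap - 1)

/-- The operator `∑_r c(z_r) / ∏_{s ≠ r} (z_r - z_s) β_r` on `S(z_1, …, z_{n+1})`. -/
def symShiftOp {n : ℕ} (c : Polynomial S) : Module.End S (RatFun S (n + 1)) :=
  ∑ r : Fin (n + 1),
    LinearMap.mulLeft S
        (Polynomial.aeval (ratZ S r) c / ∏ s ∈ Finset.univ.erase r, (ratZ S r - ratZ S s))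
      * (ratBeta S r).toLinearMap

/-- The operator `∂_n ⋯ ∂_1 c(z_1) β_1` on `S(z_1, …, z_{n+1})`. -/
def divDiffOp {n : ℕ} (c : Polynomial S) : Module.End S (RatFun S (n + 1)) :=
  (List.ofFn fun r : Fin n => divDiff S r).reverse.prod
    * (LinearMap.mulLeft S (Polynomial.aeval (ratZ S (0 : Fin (n + 1))) c)
      * (ratBeta S (0 : Fin (n + 1))).toLinearMap)

end RatFun

/-! ### Invertibility of the denominator of `Hᵢ(u)` -/

theorem isUnit_uVar (S : Type*) [CommRing S] : IsUnit (uVar S) := by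
  refine IsUnit.of_mul_eq_one (HahnSeries.single 1 1) ?_
  simp [uVar, HahnSeries.single_mul_single]

theorem isUnit_genSeries {S : Type*} [CommRing S] (g : ℕ → S) (h : g 0 = 1) :
    IsUnit (genSeries g) := by
  have : IsUnit (PowerSeries.mk g) := by
    rw [PowerSeries.isUnit_iff_constantCoeff]
    simp [← PowerSeries.coeff_zero_eq_constantCoeff_apply, h]
  exact this.map (HahnSeries.ofPowerSeries ℤ S)

theorem isUnit_uVar_sub {S : Type*} [CommRing S] (a : S) :
    IsUnit (uVar S - HahnSeries.C a) := by
  have h : uVar S - HahnSeries.C a =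
      uVar S * HahnSeries.ofPowerSeries ℤ S (1 - PowerSeries.C a * PowerSeries.X) := by
    simp only [map_sub, map_one, map_mul, HahnSeries.ofPowerSeries_C, HahnSeries.ofPowerSeries_X,
      mul_sub, mul_one, uVar]
    congr 1
    rw [mul_left_comm, HahnSeries.single_mul_single]
    simp
  rw [h]
  refine (isUnit_uVar S).mul (IsUnit.map _ ?_)
  rw [PowerSeries.isUnit_iff_constantCoeff]
  simp

theorem Datum.isUnit_hDenom {I : Type*} [Fintype I] (D : Datum I) (i : I) :
    IsUnit (D.hDenom i) := by
  have h2 : (2 : LaurentSeries (CPoly I)) = HahnSeries.C (2 : CPoly I) := (map_ofNat _ 2).symm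
  refine (((isUnit_uVar _).pow _).mul (IsUnit.pow _ ?_)).mul
    ((isUnit_genSeries _ ?_).mul (isUnit_genSeries _ ?_))
  · rw [h2]; exact isUnit_uVar_sub _
  · simp [cA]
  · simp [cA]

end ShiftedYangian

end

/-!
The action is constructed on the field `K` of fractions of `P` and then restricted to `P^Σ`.

On `K`, the generators `E_i^{(p+1)}` and `F_i^{(p+1)}` act by sums of weighted shift operators
`a_v x_v^p σ_v` over the variables `v = (i, r)`, where `σ_v` moves the point `x_v` by `-2` for `E` and
by `2` for `F`. The relations among the `E` and among the `F` reduce to relations between two or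
three such terms. They follow from a single exchange relation, which compares `a_v σ_v(a_w)` with
`a_w σ_w(a_v)` and involves only `x_v - x_w` and the pairing of the colours of `v` and `w`
(`ShiftFamily`, with the consequences `shiftSum_exchange`, `shiftSum_commute` and
`shiftSum_serre`). Both families of currents satisfy it because each coefficient is a product of
factors in pairs of variables (`shiftFamily_ptCoef`); the two families correspond to the two
opposite orientations of the bipartite graph. In the commutator of `E` and `F` the terms at
distinct points cancel, and the remaining terms are twice the residues of `u^{p+q} H_i(u)` at its
simple poles `z_{i,r}` and `z_{i,r} + 2`. Since `H_i(u)` acts as a rational function, the sum of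
these residues is the coefficient of `H_i(u)` in question (`coeff_of_mul_prod_eq`,
`opE_opF_eq_mulLeft`).

The operators preserve `P^Σ`, and the divided difference formula holds, for the same reason: if the
symmetric group permutes a family `g_1, …, g_m` along with the variables, then
`∂_k ⋯ ∂_1 g_1 = ∑_{r ≤ k+1} g_r / ∏_{s ≤ k+1, s ≠ r} (z_r - z_s)` (`divDiff_lagrangeSum`). For
`k = m - 1` the right hand side is symmetric, while the left hand side is a polynomial when `g_1`
is one.

Uniqueness holds because the series prescribe the images of all generators.
-/

noncomputable section

open scoped Classical

namespace ShiftedYangian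

/-! ### Weighted shift operators -/

section ShiftTerm

variable {k K : Type*} [Field k] [Field K] [Algebra k K]

/-- The operator `a x^p σ` on a field `K`: apply the automorphism `σ`, then multiply by `a x^p`. -/
def shiftTerm (a x : K) (σ : K ≃ₐ[k] K) (p : ℕ) : Module.End k K :=
  LinearMap.mulLeft k (a * x ^ p) * σ.toLinearMap

@[simp] theorem shiftTerm_apply (a x : K) (σ : K ≃ₐ[k] K) (p : ℕ) (f : K) :
    shiftTerm a x σ p f = a * x ^ p * σ f := rfl

variable {V : Type*} {a x : V → K} {σ : V → K ≃ₐ[k] K} {h : ℤ}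

/-- The relation of the currents, termwise: at two distinct points both sides are multiples of
`x_v^p x_w^q σ_v σ_w`, and the coefficients agree by the exchange relation `hex`. -/
theorem shiftTerm_exchange (hσ : ∀ v w f, σ v (σ w f) = σ w (σ v f)) {v w : V} {c : ℤ}
    (hvw : σ v (x w) = x w) (hwv : σ w (x v) = x v)
    (hex : (x v - x w + h * c) * (a v * σ v (a w)) = (x v - x w - h * c) * (a w * σ w (a v)))
    (p q : ℕ) :
    ⁅shiftTerm (a v) (x v) (σ v) (p + 1), shiftTerm (a w) (x w) (σ w) q⁆
      - ⁅shiftTerm (a v) (x v) (σ v) p, shiftTerm (a w) (x w) (σ w) (q + 1)⁆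
      = -((h * c) • (shiftTerm (a v) (x v) (σ v) p * shiftTerm (a w) (x w) (σ w) q
          + shiftTerm (a w) (x w) (σ w) q * shiftTerm (a v) (x v) (σ v) p)) := by
  ext f
  simp only [Ring.lie_def, LinearMap.sub_apply, Module.End.mul_apply, shiftTerm_apply, map_mul,
    map_pow, hvw, hwv, LinearMap.neg_apply, LinearMap.smul_apply, LinearMap.add_apply, hσ w v f]
  rw [zsmul_eq_mul, Int.cast_mul]
  linear_combination (x v ^ p * x w ^ q * σ v (σ w f)) * hex

/-- The relation of the currents at a single point. No condition on the coefficient is needed, since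
`a_v σ_v(a_v)` is a common factor; the pairing is `2` here. -/
theorem shiftTerm_exchange_self {v : V} (hv : σ v (x v) = x v + 2 * h) (p q : ℕ) :
    ⁅shiftTerm (a v) (x v) (σ v) (p + 1), shiftTerm (a v) (x v) (σ v) q⁆
      - ⁅shiftTerm (a v) (x v) (σ v) p, shiftTerm (a v) (x v) (σ v) (q + 1)⁆
      = -((h * 2) • (shiftTerm (a v) (x v) (σ v) p * shiftTerm (a v) (x v) (σ v) q
          + shiftTerm (a v) (x v) (σ v) q * shiftTerm (a v) (x v) (σ v) p)) := by
  ext f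
  simp only [Ring.lie_def, LinearMap.sub_apply, Module.End.mul_apply, shiftTerm_apply, map_mul,
    map_pow, hv, LinearMap.neg_apply, LinearMap.smul_apply, LinearMap.add_apply]
  rw [zsmul_eq_mul, Int.cast_mul, Int.cast_ofNat]
  ring

/-- Weighted shift operators at different points commute if their coefficients do so up to the
shifts. The two operators may shift in opposite directions. -/
theorem shiftTerm_commute {a x b y : K} {σ τ : K ≃ₐ[k] K} (hστ : ∀ f, σ (τ f) = τ (σ f))
    (hy : σ y = y) (hx : τ x = x) (hab : a * σ b = b * τ a) (p q : ℕ) :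
    ⁅shiftTerm a x σ p, shiftTerm b y τ q⁆ = 0 := by
  ext f
  simp only [Ring.lie_def, LinearMap.sub_apply, Module.End.mul_apply, shiftTerm_apply, map_mul,
    map_pow, hx, hy, hστ f, LinearMap.zero_apply]
  linear_combination (x ^ p * y ^ q * τ (σ f)) * hab

/-- The Serre relation for three distinct points, `v` and `w` of one colour and `y` of an adjacent
one. The exchange relations make the coefficients of the six orders of the three operators
proportional, with explicit factors, and the alternating sum of these factors vanishes. -/
theorem shiftTerm_serre (hσ : ∀ v w f, σ v (σ w f) = σ w (σ v f)) {v w y : V}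
    (hx : ∀ v w, v ≠ w → σ v (x w) = x w)
    (hne : ∀ v w, v ≠ w → ∀ n : ℤ, x v - x w + n ≠ 0)
    (hvw : v ≠ w) (hvy : v ≠ y) (hwy : w ≠ y)
    (evw : (x v - x w + h * 2) * (a v * σ v (a w)) = (x v - x w - h * 2) * (a w * σ w (a v)))
    (evy : (x v - x y - h) * (a v * σ v (a y)) = (x v - x y + h) * (a y * σ y (a v)))
    (ewy : (x w - x y - h) * (a w * σ w (a y)) = (x w - x y + h) * (a y * σ y (a w)))
    (p q r : ℕ) :
    ⁅shiftTerm (a v) (x v) (σ v) p, ⁅shiftTerm (a w) (x w) (σ w) q,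
        shiftTerm (a y) (x y) (σ y) r⁆⁆
      + ⁅shiftTerm (a w) (x w) (σ w) q, ⁅shiftTerm (a v) (x v) (σ v) p,
        shiftTerm (a y) (x y) (σ y) r⁆⁆ = 0 := by
  ext f
  simp only [Ring.lie_def, LinearMap.sub_apply, Module.End.mul_apply, shiftTerm_apply, map_mul,
    map_pow, LinearMap.add_apply, LinearMap.zero_apply, map_sub, hx v w hvw, hx w v hvw.symm,
    hx v y hvy, hx y v hvy.symm, hx w y hwy, hx y w hwy.symm]
  rw [hσ y v (σ w f), hσ y w (σ v f), hσ y w f, hσ y v f, hσ w v (σ y f)]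
  have e2 := congrArg (σ w) evy
  have e3 := congrArg (σ v) ewy
  simp only [map_mul, map_add, map_sub, map_intCast, hx v w hvw, hx w v hvw.symm,
    hx v y hvy, hx w y hwy] at e2 e3
  rw [hσ w v (a y)] at e2
  have n2 : x v - x w - h * 2 ≠ 0 := by
    simpa [sub_eq_add_neg] using hne v w hvw (-(h * 2))
  have n3 : x v - x y + h ≠ 0 := hne v y hvy h
  have n5 : x w - x y + h ≠ 0 := hne w y hwy h
  -- `t` is chosen so that no order of the three operators gets a denominator below.
  have u1 : ∃ t, a v * σ v (a w) * σ v (σ w (a y))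
      = (x v - x w - h * 2) * (x v - x y + h) * (x w - x y + h) * t :=
    ⟨_, (mul_div_cancel₀ _ (mul_ne_zero (mul_ne_zero n2 n3) n5)).symm⟩
  obtain ⟨t, u1⟩ := u1
  have u2 : a v * σ v (a y) * σ v (σ y (a w))
      = (x v - x w - h * 2) * (x v - x y + h) * (x w - x y - h) * t := by
    refine mul_left_cancel₀ n5 ?_
    linear_combination (x w - x y - h) * u1 - a v * e3
  have u3 : a y * σ y (a v) * σ y (σ v (a w))
      = (x v - x w - h * 2) * (x v - x y - h) * (x w - x y - h) * t := by
    refine mul_left_cancel₀ n3 ?_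
    rw [hσ y v (a w)]
    linear_combination (x v - x y - h) * u2 - σ v (σ y (a w)) * evy
  have u1' : a w * σ w (a v) * σ v (σ w (a y))
      = (x v - x w + h * 2) * (x v - x y + h) * (x w - x y + h) * t := by
    refine mul_left_cancel₀ n2 ?_
    linear_combination (x v - x w + h * 2) * u1 - σ v (σ w (a y)) * evw
  have u2' : a w * σ w (a y) * σ w (σ y (a v))
      = (x v - x w + h * 2) * (x v - x y - h) * (x w - x y + h) * t := by
    refine mul_left_cancel₀ n3 ?_
    linear_combination (x v - x y - h) * u1' - a w * e2
  have u3' : a y * σ y (a w) * σ y (σ w (a v))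
      = (x v - x w + h * 2) * (x v - x y - h) * (x w - x y - h) * t := by
    refine mul_left_cancel₀ n5 ?_
    rw [hσ y w (a v)]
    linear_combination (x w - x y - h) * u2' - σ w (σ y (a v)) * ewy
  rw [hσ w v (a y)]
  linear_combination (x v ^ p * x w ^ q * x y ^ r * σ v (σ w (σ y f)))
    * (u1 - 2 * u2 + u3 + u1' - 2 * u2' + u3')

/-- The Serre relation where the two operators of the same colour sit at the same point `v`. -/
theorem shiftTerm_serre_self (hσ : ∀ v w f, σ v (σ w f) = σ w (σ v f)) {v y : V}
    (hv : σ v (x v) = x v + 2 * h) (hvy : σ v (x y) = x y) (hyv : σ y (x v) = x v)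
    (hne : ∀ n : ℤ, x v - x y + n ≠ 0)
    (evy : (x v - x y - h) * (a v * σ v (a y)) = (x v - x y + h) * (a y * σ y (a v)))
    (p q r : ℕ) :
    ⁅shiftTerm (a v) (x v) (σ v) p, ⁅shiftTerm (a v) (x v) (σ v) q,
        shiftTerm (a y) (x y) (σ y) r⁆⁆
      + ⁅shiftTerm (a v) (x v) (σ v) q, ⁅shiftTerm (a v) (x v) (σ v) p,
        shiftTerm (a y) (x y) (σ y) r⁆⁆ = 0 := by
  ext f
  simp only [Ring.lie_def, LinearMap.sub_apply, Module.End.mul_apply, shiftTerm_apply, map_mul,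
    map_pow, LinearMap.add_apply, LinearMap.zero_apply, map_sub, hv, hvy, hyv, map_add, map_ofNat,
    map_intCast]
  rw [hσ y v (σ v f), hσ y v f]
  have e2 := congrArg (σ v) evy
  simp only [map_mul, map_add, map_sub, map_intCast, hv, hvy] at e2
  have n3 : x v - x y + h ≠ 0 := hne h
  have u1 : ∃ t, a v * σ v (a y) * σ v (σ y (a v)) = (x v - x y + h) * t :=
    ⟨_, (mul_div_cancel₀ _ n3).symm⟩
  obtain ⟨t, u1⟩ := u1
  have u2 : a v * σ v (a v) * σ v (σ v (a y)) = (x v - x y + 3 * h) * t := by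
    refine mul_left_cancel₀ n3 ?_
    linear_combination (x v - x y + 3 * h) * u1 + a v * e2
  have u3 : a y * σ y (a v) * σ y (σ v (a v)) = (x v - x y - h) * t := by
    refine mul_left_cancel₀ n3 ?_
    rw [hσ y v (a v)]
    linear_combination (x v - x y - h) * u1 - σ v (σ y (a v)) * evy
  linear_combination ((x v ^ p * (x v + 2 * h) ^ q + x v ^ q * (x v + 2 * h) ^ p) * x y ^ r
    * σ v (σ v (σ y f))) * (u2 - 2 * u1 + u3)

end ShiftTerm

theorem sum_bracket {B ι : Type*} [Ring B] [Fintype ι] (f : ι → B) (b : B) :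
    ⁅∑ r, f r, b⁆ = ∑ r, ⁅f r, b⁆ := by
  simp only [Ring.lie_def, Finset.mul_sum, Finset.sum_mul, Finset.sum_sub_distrib]

theorem bracket_sum {B ι : Type*} [Ring B] [Fintype ι] (b : B) (f : ι → B) :
    ⁅b, ∑ r, f r⁆ = ∑ r, ⁅b, f r⁆ := by
  simp only [Ring.lie_def, Finset.mul_sum, Finset.sum_mul, Finset.sum_sub_distrib]

theorem sum_bracket_sum_bracket_sum {B ι κ ν : Type*} [Ring B] [Fintype ι] [Fintype κ]
    [Fintype ν] (f : ι → B) (g : κ → B) (e : ν → B) :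
    ⁅∑ r, f r, ⁅∑ s, g s, ∑ t, e t⁆⁆ = ∑ r, ∑ s, ∑ t, ⁅f r, ⁅g s, e t⁆⁆ := by
  rw [sum_bracket]
  refine Finset.sum_congr rfl fun r _ => ?_
  rw [sum_bracket, bracket_sum]
  refine Finset.sum_congr rfl fun s _ => ?_
  rw [bracket_sum, bracket_sum]

/-- Coefficients `a`, points `x` and commuting automorphisms `σ`, indexed by the variables
`z_{i,r}`, such that `σ_v` shifts `x_v` by `2h` and fixes the other points, distinct points do not
differ by an integer, and the coefficients satisfy the exchange relation that underlies the
relations among currents of one kind. The currents `E_i(u)` have `h = -1`, and `F_i(u)` have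
`h = 1`. -/
structure ShiftFamily {I : Type*} [Fintype I] (D : Datum I) {k K : Type*} [Field k] [Field K]
    [Algebra k K] (h : ℤ) (a x : D.Var → K) (σ : D.Var → K ≃ₐ[k] K) : Prop where
  comm : ∀ v w f, σ v (σ w f) = σ w (σ v f)
  self : ∀ v, σ v (x v) = x v + 2 * h
  other : ∀ v w, v ≠ w → σ v (x w) = x w
  generic : ∀ v w, v ≠ w → ∀ n : ℤ, x v - x w + n ≠ 0
  exchange : ∀ v w, v ≠ w →
    (x v - x w + h * dot D.graph v.1 w.1) * (a v * σ v (a w))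
      = (x v - x w - h * dot D.graph v.1 w.1) * (a w * σ w (a v))

/-- The operator `∑_r a_{i,r} x_{i,r}^p σ_{i,r}`. -/
def Datum.shiftSum {I : Type*} [Fintype I] (D : Datum I) {k K : Type*} [Field k] [Field K]
    [Algebra k K] (a x : D.Var → K) (σ : D.Var → K ≃ₐ[k] K) (i : I) (p : ℕ) : Module.End k K :=
  ∑ r : Fin (D.m i), shiftTerm (a ⟨i, r⟩) (x ⟨i, r⟩) (σ ⟨i, r⟩) p

namespace ShiftFamily

variable {I : Type*} [Fintype I] {D : Datum I} {k K : Type*} [Field k] [Field K]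
  [Algebra k K] {h : ℤ} {a x : D.Var → K} {σ : D.Var → K ≃ₐ[k] K}

theorem shiftSum_exchange (H : ShiftFamily D h a x σ) (i j : I) (p q : ℕ) :
    ⁅D.shiftSum a x σ i (p + 1), D.shiftSum a x σ j q⁆
      - ⁅D.shiftSum a x σ i p, D.shiftSum a x σ j (q + 1)⁆
      = -((h * dot D.graph i j) • (D.shiftSum a x σ i p * D.shiftSum a x σ j q
          + D.shiftSum a x σ j q * D.shiftSum a x σ i p)) := by
  simp only [Datum.shiftSum]
  rw [Finset.sum_mul_sum, Finset.sum_mul_sum,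
    Finset.sum_comm (s := (Finset.univ : Finset (Fin (D.m j))))]
  simp only [LieRing.of_associative_ring_bracket, Finset.sum_mul_sum]
  rw [Finset.sum_comm (s := (Finset.univ : Finset (Fin (D.m j)))),
    Finset.sum_comm (s := (Finset.univ : Finset (Fin (D.m j))))]
  simp only [← Finset.sum_sub_distrib, ← Finset.sum_add_distrib, Finset.smul_sum,
    ← Finset.sum_neg_distrib]
  refine Finset.sum_congr rfl fun r _ => Finset.sum_congr rfl fun s _ => ?_
  by_cases hrs : (⟨i, r⟩ : D.Var) = ⟨j, s⟩
  · obtain rfl : i = j := congrArg Sigma.fst hrs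
    obtain rfl : r = s := by simpa using hrs
    have := shiftTerm_exchange_self (a := a) (H.self ⟨i, r⟩) p q
    simpa [dot, Ring.lie_def] using this
  · exact shiftTerm_exchange H.comm (H.other _ _ hrs) (H.other _ _ (Ne.symm hrs))
      (H.exchange _ _ hrs) p q

theorem shiftSum_commute (H : ShiftFamily D h a x σ) {i j : I} (hij : i ≠ j)
    (hadj : ¬ D.graph.Adj i j) (p q : ℕ) :
    ⁅D.shiftSum a x σ i p, D.shiftSum a x σ j q⁆ = 0 := by
  simp only [Datum.shiftSum, LieRing.of_associative_ring_bracket, Finset.sum_mul_sum]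
  rw [Finset.sum_comm (s := (Finset.univ : Finset (Fin (D.m j))))]
  simp only [← Finset.sum_sub_distrib]
  refine Finset.sum_eq_zero fun r _ => Finset.sum_eq_zero fun s _ => ?_
  have hrs : (⟨i, r⟩ : D.Var) ≠ ⟨j, s⟩ := fun h => hij (congrArg Sigma.fst h)
  refine shiftTerm_commute (H.comm _ _) (H.other _ _ hrs) (H.other _ _ hrs.symm) ?_ p q
  have := H.exchange _ _ hrs
  simp only [dot, hij, hadj, if_false, Int.cast_zero, mul_zero, add_zero, sub_zero] at this
  exact mul_left_cancel₀ (by simpa using H.generic _ _ hrs 0) this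

theorem shiftSum_serre (H : ShiftFamily D h a x σ) {i j : I} (hadj : D.graph.Adj i j)
    (p q r : ℕ) :
    ⁅D.shiftSum a x σ i p, ⁅D.shiftSum a x σ i q, D.shiftSum a x σ j r⁆⁆
      + ⁅D.shiftSum a x σ i q, ⁅D.shiftSum a x σ i p, D.shiftSum a x σ j r⁆⁆ = 0 := by
  have hij : i ≠ j := hadj.ne
  have dij : dot D.graph i j = -1 := by simp [dot, hij, hadj]
  simp only [Datum.shiftSum, sum_bracket_sum_bracket_sum]
  -- After exchanging the sums over `i` in the second bracket, the two brackets cancel termwise.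
  rw [Finset.sum_comm (γ := Fin (D.m i)) (f := fun r' r => ∑ s : Fin (D.m j),
    ⁅shiftTerm (a ⟨i, r'⟩) (x ⟨i, r'⟩) (σ ⟨i, r'⟩) q, _⁆)]
  simp only [← Finset.sum_add_distrib]
  refine Finset.sum_eq_zero fun v _ => Finset.sum_eq_zero fun w _ =>
    Finset.sum_eq_zero fun y _ => ?_
  have hne (v : Fin (D.m i)) (y : Fin (D.m j)) : (⟨i, v⟩ : D.Var) ≠ ⟨j, y⟩ :=
    fun h => hij (congrArg Sigma.fst h)
  have hex (v : Fin (D.m i)) (y : Fin (D.m j)) := H.exchange _ _ (hne v y)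
  simp only [dij, Int.cast_neg, Int.cast_one, mul_neg, mul_one, ← sub_eq_add_neg,
    sub_neg_eq_add] at hex
  by_cases hvw : v = w
  · subst hvw
    exact shiftTerm_serre_self H.comm (H.self _) (H.other _ _ (hne v y))
      (H.other _ _ (hne v y).symm) (H.generic _ _ (hne v y)) (hex v y) p q r
  · have hvw' : (⟨i, v⟩ : D.Var) ≠ ⟨i, w⟩ := by simpa using hvw
    refine shiftTerm_serre H.comm H.other H.generic hvw' (hne v y) (hne w y) ?_ (hex v y)
      (hex w y) p q r
    simpa [dot] using H.exchange _ _ hvw'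

end ShiftFamily

/-! ### Divided differences -/

section LagrangeSum

variable {K ι : Type*} [Field K] [DecidableEq ι]

/-- The sum `∑_{r ∈ A} g_r / ∏_{s ∈ A, s ≠ r} (z_r - z_s)`. -/
def lagrangeSum (z g : ι → K) (A : Finset ι) : K :=
  ∑ r ∈ A, g r / ∏ s ∈ A.erase r, (z r - z s)

theorem lagrangeSum_insert (z g : ι → K) {A : Finset ι} {a : ι} (ha : a ∉ A) :
    lagrangeSum z g (insert a A) = g a / ∏ s ∈ A, (z a - z s)
      + ∑ r ∈ A, g r / ((z r - z a) * ∏ s ∈ A.erase r, (z r - z s)) := by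
  rw [lagrangeSum, Finset.sum_insert ha, Finset.erase_insert ha]
  congr 1
  refine Finset.sum_congr rfl fun r hr => ?_
  have hra : a ≠ r := fun h => ha (h ▸ hr)
  rw [Finset.erase_insert_of_ne hra, Finset.prod_insert fun h => ha (Finset.mem_of_mem_erase h)]

theorem map_lagrangeSum {z g : ι → K} (φ : K →+* K) (π : Equiv.Perm ι)
    (hz : ∀ r, φ (z r) = z (π r)) (hg : ∀ r, φ (g r) = g (π r)) (A : Finset ι) :
    φ (lagrangeSum z g A) = lagrangeSum z g (A.map π.toEmbedding) := by
  simp only [lagrangeSum, map_sum, map_div₀, map_prod, map_sub, hz, hg, Finset.sum_map,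
    Equiv.coe_toEmbedding]
  refine Finset.sum_congr rfl fun r _ => ?_
  rw [show (A.map π.toEmbedding).erase (π r) = (A.erase r).map π.toEmbedding by
    rw [Finset.map_erase]; rfl, Finset.prod_map]
  rfl

/-- Exchanging `a` and `b` and taking the divided difference enlarges the index set of a Lagrange
sum by one element. -/
theorem divDiff_lagrangeSum {z g : ι → K} (hinj : Function.Injective z) {A : Finset ι} {a b : ι}
    (hab : a ≠ b) (ha : a ∉ A) (hb : b ∉ A) (φ : K →+* K)
    (hz : ∀ r, φ (z r) = z (Equiv.swap a b r)) (hg : ∀ r, φ (g r) = g (Equiv.swap a b r)) :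
    (z b - z a)⁻¹ * (φ (lagrangeSum z g (insert a A)) - lagrangeSum z g (insert a A))
      = lagrangeSum z g (insert b (insert a A)) := by
  have hmap : (insert a A).map (Equiv.swap a b).toEmbedding = insert b A := by
    rw [Finset.map_insert]
    congr 1
    · simp
    · ext x
      simp only [Finset.mem_map, Equiv.coe_toEmbedding]
      constructor
      · rintro ⟨y, hy, rfl⟩
        rwa [Equiv.swap_apply_of_ne_of_ne (ne_of_mem_of_not_mem hy ha)
          (ne_of_mem_of_not_mem hy hb)]
      · intro hx
        exact ⟨x, hx, Equiv.swap_apply_of_ne_of_ne (ne_of_mem_of_not_mem hx ha)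
          (ne_of_mem_of_not_mem hx hb)⟩
  have hne {r s : ι} (h : r ≠ s) : z r - z s ≠ 0 := sub_ne_zero.2 (hinj.ne h)
  have hprod (r : ι) (B : Finset ι) (hB : r ∉ B) : ∏ s ∈ B, (z r - z s) ≠ 0 :=
    Finset.prod_ne_zero_iff.2 fun s hs => hne fun h => hB (h ▸ hs)
  have hba : b ∉ insert a A := by simp [hb, hab.symm]
  rw [map_lagrangeSum φ _ hz hg, hmap, lagrangeSum_insert z g ha, lagrangeSum_insert z g hb,
    lagrangeSum_insert z g hba, Finset.sum_insert ha, Finset.prod_insert ha,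
    Finset.erase_insert ha, add_sub_add_comm, ← Finset.sum_sub_distrib, mul_add, Finset.mul_sum,
    ← add_assoc]
  have hzab := hne hab
  have hzba := hne hab.symm
  congr 1
  · have h1 := hprod a A ha
    have h2 := hprod b A hb
    field_simp
    ring
  · refine Finset.sum_congr rfl fun r hr => ?_
    have hra : r ≠ a := fun h => ha (h ▸ hr)
    have hrb : r ≠ b := fun h => hb (h ▸ hr)
    have h1 := hprod r (A.erase r) (Finset.notMem_erase _ _)
    have h2 := hne hra
    have h3 := hne hrb
    rw [Finset.erase_insert_of_ne hra.symm,
      Finset.prod_insert fun h => ha (Finset.mem_of_mem_erase h)]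
    field_simp
    ring

theorem divDiff_lagrangeSum_Iic {n : ℕ} {z g : Fin (n + 1) → K} (hinj : Function.Injective z)
    (k : Fin n) (φ : K →+* K)
    (hz : ∀ r, φ (z r) = z (Equiv.swap k.castSucc k.succ r))
    (hg : ∀ r, φ (g r) = g (Equiv.swap k.castSucc k.succ r)) :
    (z k.succ - z k.castSucc)⁻¹ * (φ (lagrangeSum z g (Finset.Iic k.castSucc))
        - lagrangeSum z g (Finset.Iic k.castSucc))
      = lagrangeSum z g (Finset.Iic k.succ) := by
  have h1 : Finset.Iic k.castSucc = insert k.castSucc (Finset.Iio k.castSucc) := by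
    ext x; simp [le_iff_eq_or_lt]
  have h2 : Finset.Iic k.succ = insert k.succ (insert k.castSucc (Finset.Iio k.castSucc)) := by
    ext x
    simp only [Finset.mem_Iic, Finset.mem_insert, Finset.mem_Iio, Fin.le_def, Fin.lt_def,
      Fin.ext_iff, Fin.val_succ, Fin.val_castSucc]
    omega
  rw [h2, h1]
  exact divDiff_lagrangeSum hinj (Fin.castSucc_lt_succ (i := k)).ne (by simp)
    (by simp [Fin.le_def]) φ hz hg

/-- If `R` is stable under divided differences, Lagrange sums of families in `R` that the
transpositions permute lie in `R`. -/
theorem lagrangeSum_mem {n : ℕ} {z g : Fin n → K} (hinj : Function.Injective z)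
    (φ : Fin n → Fin n → K →+* K) (hz : ∀ a b r, φ a b (z r) = z (Equiv.swap a b r))
    (hg : ∀ a b r, φ a b (g r) = g (Equiv.swap a b r)) (R : Subring K)
    (hR : ∀ a b, ∀ f ∈ R, (z b - z a)⁻¹ * (φ a b f - f) ∈ R) (hgR : ∀ r, g r ∈ R) :
    lagrangeSum z g Finset.univ ∈ R := by
  cases n with
  | zero => simp [lagrangeSum, R.zero_mem]
  | succ n =>
    have key (k : Fin (n + 1)) : lagrangeSum z g (Finset.Iic k) ∈ R := by
      induction k using Fin.induction with
      | zero =>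
        have : Finset.Iic (0 : Fin (n + 1)) = {0} := by ext; simp
        simpa [lagrangeSum, this] using hgR 0
      | succ k ih =>
        rw [← divDiff_lagrangeSum_Iic hinj k (φ _ _) (hz _ _) (hg _ _)]
        exact hR _ _ _ ih
    have : Finset.Iic (Fin.last n) = Finset.univ := by ext x; simp [Fin.le_last]
    exact this ▸ key (Fin.last n)

end LagrangeSum

/-- Induction along the product `f_{n-1} ⋯ f_1 f_0`, of which `f_0` acts first. -/
theorem reverse_prod_ofFn_induction {S M : Type*} [Semiring S] [AddCommMonoid M] [Module S M]
    {n : ℕ} (f : Fin n → Module.End S M) (p : Fin (n + 1) → M → Prop)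
    (step : ∀ k x, p k.castSucc x → p k.succ (f k x)) {x : M} (h0 : p 0 x) :
    p (Fin.last n) ((List.ofFn f).reverse.prod x) := by
  induction n with
  | zero => simpa using h0
  | succ n ih =>
    rw [List.ofFn_succ', List.concat_eq_append, List.reverse_concat, List.prod_cons]
    exact step (Fin.last n) _ (ih (fun k => f k.castSucc) (fun k => p k.castSucc)
      (fun k x hx => step k.castSucc x hx) h0)

/-! ### Automorphisms of rational function fields -/

section FracEquiv

variable {S : Type*} [CommRing S] {τ : Type*}

theorem beta_X (v w : τ) :
    beta S v (MvPolynomial.X w) = MvPolynomial.X w + if w = v then 2 else 0 := by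
  simp [beta]

theorem beta_symm_X (v w : τ) :
    (beta S v).symm (MvPolynomial.X w) = MvPolynomial.X w - if w = v then 2 else 0 := by
  simp [beta]

theorem renameEquiv_beta (π : Equiv.Perm τ) (v : τ) (f : MvPolynomial τ S) :
    MvPolynomial.renameEquiv S π (beta S v f) = beta S (π v) (MvPolynomial.renameEquiv S π f) := by
  refine DFunLike.congr_fun (f := ((MvPolynomial.renameEquiv S π).toAlgHom.comp
    (beta S v).toAlgHom)) (g := (beta S (π v)).toAlgHom.comp
    (MvPolynomial.renameEquiv S π).toAlgHom) (MvPolynomial.algHom_ext fun w => ?_) f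
  have h2 : MvPolynomial.rename (R := S) π 2 = 2 := map_ofNat _ 2
  by_cases h : w = v <;> simp [beta_X, h, h2]

theorem renameEquiv_beta_symm (π : Equiv.Perm τ) (v : τ) (f : MvPolynomial τ S) :
    MvPolynomial.renameEquiv S π ((beta S v).symm f)
      = (beta S (π v)).symm (MvPolynomial.renameEquiv S π f) := by
  rw [AlgEquiv.eq_symm_apply, ← renameEquiv_beta, AlgEquiv.apply_symm_apply]

theorem beta_comm (v w : τ) (f : MvPolynomial τ S) :
    beta S v (beta S w f) = beta S w (beta S v f) := by
  refine DFunLike.congr_fun (f := (beta S v).toAlgHom.comp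
    (beta S w).toAlgHom) (g := (beta S w).toAlgHom.comp
    (beta S v).toAlgHom) (MvPolynomial.algHom_ext fun u => ?_) f
  have h2 (v : τ) : beta S v 2 = 2 := map_ofNat _ 2
  change beta S v (beta S w (MvPolynomial.X u)) = beta S w (beta S v (MvPolynomial.X u))
  simp only [beta_X, map_add]
  split_ifs <;> simp [*]

/-- Modulo `z_b - z_a`, exchanging `z_a` and `z_b` does nothing. -/
theorem X_sub_X_dvd_rename_swap_sub [DecidableEq τ] (a b : τ) (f : MvPolynomial τ S) :
    MvPolynomial.X b - MvPolynomial.X a ∣ MvPolynomial.rename (Equiv.swap a b) f - f := by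
  rw [← Ideal.mem_span_singleton, ← Ideal.Quotient.eq]
  set J := Ideal.span {(MvPolynomial.X b - MvPolynomial.X a : MvPolynomial τ S)}
  refine DFunLike.congr_fun (f := (Ideal.Quotient.mkₐ S J).comp
    (MvPolynomial.rename (Equiv.swap a b))) (g := Ideal.Quotient.mkₐ S J)
    (MvPolynomial.algHom_ext fun u => ?_) f
  have hab : Ideal.Quotient.mk J (MvPolynomial.X b) = Ideal.Quotient.mk J (MvPolynomial.X a) :=
    Ideal.Quotient.eq.2 (Ideal.mem_span_singleton_self _)
  by_cases h : u = a
  · subst h; simpa using hab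
  by_cases h' : u = b
  · subst h'; simpa using hab.symm
  simp [Equiv.swap_apply_of_ne_of_ne h h']

/-- The automorphism of `S(z_τ)` that extends an automorphism of `S[z_τ]`. -/
def fracEquiv (e : MvPolynomial τ S ≃ₐ[S] MvPolynomial τ S) :
    FractionRing (MvPolynomial τ S) ≃ₐ[S] FractionRing (MvPolynomial τ S) :=
  IsFractionRing.algEquivOfAlgEquiv e

@[simp] theorem fracEquiv_algebraMap (e : MvPolynomial τ S ≃ₐ[S] MvPolynomial τ S)
    (f : MvPolynomial τ S) :
    fracEquiv e (algebraMap _ (FractionRing (MvPolynomial τ S)) f) = algebraMap _ _ (e f) :=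
  IsFractionRing.algEquivOfAlgEquiv_algebraMap _ _

variable [IsDomain S]

/-- An identity between composites of two automorphisms of the polynomial ring persists on
fractions. -/
theorem fracEquiv_comm {e₁ e₂ e₃ e₄ : MvPolynomial τ S ≃ₐ[S] MvPolynomial τ S}
    (h : ∀ f, e₁ (e₂ f) = e₃ (e₄ f)) (f : FractionRing (MvPolynomial τ S)) :
    fracEquiv e₁ (fracEquiv e₂ f) = fracEquiv e₃ (fracEquiv e₄ f) := by
  obtain ⟨x, y, -, rfl⟩ := IsFractionRing.div_surjective (A := MvPolynomial τ S) f
  simp [h]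

/-- The divided difference of a polynomial with respect to two variables is a polynomial. -/
theorem divDiff_mem_range [DecidableEq τ] {a b : τ} (f : FractionRing (MvPolynomial τ S))
    (hf : f ∈ Set.range (algebraMap (MvPolynomial τ S) (FractionRing (MvPolynomial τ S)))) :
    (algebraMap (MvPolynomial τ S) (FractionRing (MvPolynomial τ S)) (MvPolynomial.X b)
        - algebraMap (MvPolynomial τ S) (FractionRing (MvPolynomial τ S)) (MvPolynomial.X a))⁻¹
      * (fracEquiv (MvPolynomial.renameEquiv S (Equiv.swap a b)) f - f)
      ∈ Set.range (algebraMap (MvPolynomial τ S) (FractionRing (MvPolynomial τ S))) := by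
  obtain ⟨f, rfl⟩ := hf
  obtain ⟨g, hg⟩ := X_sub_X_dvd_rename_swap_sub a b f
  by_cases h : algebraMap (MvPolynomial τ S) (FractionRing (MvPolynomial τ S)) (MvPolynomial.X b)
        - algebraMap (MvPolynomial τ S) (FractionRing (MvPolynomial τ S)) (MvPolynomial.X a) = 0
  · exact ⟨0, by simp [h]⟩
  · refine ⟨g, ?_⟩
    rw [eq_inv_mul_iff_mul_eq₀ h, fracEquiv_algebraMap, ← map_sub, ← map_sub, ← map_mul, ← hg]
    rfl

end FracEquiv

/-! ### Symmetrized shifts and divided differences -/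

section RatFun

variable {S : Type*} [CommRing S] {n : ℕ}

theorem ratPerm_ratZ (s : Equiv.Perm (Fin n)) (r : Fin n) :
    ratPerm S s (ratZ S r) = ratZ S (s r) := by
  refine (fracEquiv_algebraMap (MvPolynomial.renameEquiv S s) _).trans ?_
  simp [ratZ]

variable [IsDomain S]

theorem ratZ_injective : Function.Injective (ratZ S : Fin n → RatFun S n) := fun _ _ h =>
  MvPolynomial.X_injective (IsFractionRing.injective (MvPolynomial (Fin n) S) (RatFun S n) h)

theorem ratPerm_ratBeta (s : Equiv.Perm (Fin n)) (r : Fin n) (f : RatFun S n) :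
    ratPerm S s (ratBeta S r f) = ratBeta S (s r) (ratPerm S s f) :=
  fracEquiv_comm (renameEquiv_beta s r) f

theorem ratPerm_summand (c : Polynomial S) {f : RatFun S n}
    (s : Equiv.Perm (Fin n)) (hf : ratPerm S s f = f) (r : Fin n) :
    ratPerm S s (Polynomial.aeval (ratZ S r) c * ratBeta S r f)
      = Polynomial.aeval (ratZ S (s r)) c * ratBeta S (s r) f := by
  rw [map_mul, ratPerm_ratBeta, hf, ← Polynomial.aeval_algHom_apply, ratPerm_ratZ]

theorem divDiff_apply (r : Fin n) (f : RatFun S (n + 1)) :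
    divDiff S r f = (ratZ S r.succ - ratZ S r.castSucc)⁻¹
      * (ratPerm S (Equiv.swap r.castSucc r.succ) f - f) := rfl

theorem symShiftOp_apply (c : Polynomial S) (f : RatFun S (n + 1)) :
    symShiftOp S c f = lagrangeSum (ratZ S)
      (fun r => Polynomial.aeval (ratZ S r) c * ratBeta S r f) Finset.univ := by
  simp only [symShiftOp, lagrangeSum, LinearMap.sum_apply]
  refine Finset.sum_congr rfl fun r _ => ?_
  exact (div_mul_eq_mul_div _ _ _)

/-- After `k` divided differences, `c(z_1) β_1 f` has become the Lagrange sum over the first `k + 1`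
variables, because `c(z_1) β_1 f, …, c(z_m) β_m f` are permuted by the symmetric group. -/
theorem symShiftOp_eq_divDiffOp (c : Polynomial S) {f : RatFun S (n + 1)}
    (hf : ∀ s : Equiv.Perm (Fin (n + 1)), ratPerm S s f = f) :
    symShiftOp S c f = divDiffOp S c f := by
  set g : Fin (n + 1) → RatFun S (n + 1) :=
    fun r => Polynomial.aeval (ratZ S r) c * ratBeta S r f with hg
  have h := reverse_prod_ofFn_induction (divDiff S)
    (fun (k : Fin (n + 1)) x => x = lagrangeSum (ratZ S) g (Finset.Iic k)) ?_ (x := g 0) ?_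
  · have hu : Finset.Iic (Fin.last n) = Finset.univ := by ext x; simp [Fin.le_last]
    rw [symShiftOp_apply, ← hu]
    exact h.symm
  · rintro k x rfl
    exact divDiff_lagrangeSum_Iic ratZ_injective k
      (ratPerm S (Equiv.swap k.castSucc k.succ) : RatFun S (n + 1) →+* RatFun S (n + 1))
      (ratPerm_ratZ _) (ratPerm_summand c _ (hf _))
  · have : Finset.Iic (0 : Fin (n + 1)) = {0} := by ext; simp
    simp [lagrangeSum, this]

theorem ratPerm_symShiftOp (c : Polynomial S) {f : RatFun S (n + 1)}
    (hf : ∀ s : Equiv.Perm (Fin (n + 1)), ratPerm S s f = f) (s : Equiv.Perm (Fin (n + 1))) :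
    ratPerm S s (symShiftOp S c f) = symShiftOp S c f := by
  rw [symShiftOp_apply]
  refine (map_lagrangeSum (ratPerm S s : RatFun S (n + 1) →+* RatFun S (n + 1)) s
    (ratPerm_ratZ s) (ratPerm_summand c s (hf s)) _).trans ?_
  simp

theorem divDiffOp_mem_range (c : Polynomial S) (f : MvPolynomial (Fin (n + 1)) S) :
    divDiffOp S c (algebraMap _ (RatFun S (n + 1)) f)
      ∈ Set.range (algebraMap (MvPolynomial (Fin (n + 1)) S) (RatFun S (n + 1))) := by
  refine reverse_prod_ofFn_induction (divDiff S) (fun _ x =>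
    x ∈ Set.range (algebraMap (MvPolynomial (Fin (n + 1)) S) (RatFun S (n + 1))))
    (fun k x hx => ?_) ?_
  · rw [divDiff_apply]
    exact divDiff_mem_range x hx
  refine ⟨Polynomial.aeval (MvPolynomial.X 0) c * beta S 0 f, ?_⟩
  rw [map_mul]
  congr 1
  · rw [ratZ, Polynomial.aeval_algebraMap_apply]
  · exact (fracEquiv_algebraMap _ _).symm

/-- The divided differences show that the value is a polynomial, and the symmetric form of the
operator shows that it is symmetric. -/
theorem exists_symmetric_symShiftOp (c : Polynomial S) {f : MvPolynomial (Fin (n + 1)) S}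
    (hf : f.IsSymmetric) :
    ∃ g : MvPolynomial (Fin (n + 1)) S, g.IsSymmetric ∧
      symShiftOp S c (algebraMap _ (RatFun S (n + 1)) f) = algebraMap _ (RatFun S (n + 1)) g ∧
      divDiffOp S c (algebraMap _ (RatFun S (n + 1)) f) = algebraMap _ (RatFun S (n + 1)) g := by
  have key (s : Equiv.Perm (Fin (n + 1))) (f : MvPolynomial (Fin (n + 1)) S) :
      ratPerm S s (algebraMap _ _ f) = algebraMap _ _ (MvPolynomial.rename s f) :=
    fracEquiv_algebraMap _ _
  have hf' (s : Equiv.Perm (Fin (n + 1))) :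
      ratPerm S s (algebraMap _ (RatFun S (n + 1)) f) = algebraMap _ _ f := by rw [key, hf s]
  obtain ⟨g, hg⟩ := divDiffOp_mem_range c f
  have hs := symShiftOp_eq_divDiffOp c hf'
  refine ⟨g, fun s => ?_, hs.trans hg.symm, hg.symm⟩
  apply IsFractionRing.injective (MvPolynomial (Fin (n + 1)) S) (RatFun S (n + 1))
  rw [← key, hg, ← hs, ratPerm_symShiftOp c hf']

end RatFun

/-! ### Expansions in `u⁻¹` -/

section Laurent

variable {R : Type*} [CommRing R]

theorem ofPowerSeries_coeff_of_neg (s : PowerSeries R) {q : ℤ} (hq : q < 0) :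
    (HahnSeries.ofPowerSeries ℤ R s).coeff q = 0 := by
  rw [HahnSeries.ofPowerSeries_apply]
  refine HahnSeries.embDomain_of_notMem_range ?_
  rintro ⟨n, rfl⟩
  exact (Int.natCast_nonneg n).not_gt hq

theorem genSeries_coeff_natCast (g : ℕ → R) (n : ℕ) : (genSeries g).coeff n = g n := by
  rw [genSeries, HahnSeries.ofPowerSeries_apply_coeff, PowerSeries.coeff_mk]

theorem genSeries_injective : Function.Injective (genSeries : (ℕ → R) → LaurentSeries R) :=
  fun g g' h => funext fun n => by rw [← genSeries_coeff_natCast g, h, genSeries_coeff_natCast]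

theorem genSeries_mul_C (g : ℕ → R) (c : R) :
    genSeries g * HahnSeries.C c = genSeries fun n => g n * c := by
  rw [genSeries, genSeries, ← HahnSeries.ofPowerSeries_C, ← map_mul]
  congr 1
  ext n
  simp

theorem genSeries_sum {ι : Type*} (s : Finset ι) (g : ι → ℕ → R) :
    ∑ i ∈ s, genSeries (g i) = genSeries fun n => ∑ i ∈ s, g i n := by
  simp only [genSeries, ← map_sum]
  congr 1
  ext n
  simp

/-- The expansion of `(u - a)⁻¹`, as a power series in `u⁻¹`. -/
def invSub (a : R) : PowerSeries R := PowerSeries.X * PowerSeries.mk fun k => a ^ k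

theorem invSub_eq_mk (a : R) :
    invSub a = PowerSeries.mk fun n => if n = 0 then 0 else a ^ (n - 1) := by
  ext n
  cases n with
  | zero => simp [invSub]
  | succ n => simp [invSub, PowerSeries.coeff_succ_X_mul]

theorem uVar_mul_ofPowerSeries_X :
    uVar R * HahnSeries.ofPowerSeries ℤ R PowerSeries.X = 1 := by
  rw [HahnSeries.ofPowerSeries_X, uVar, HahnSeries.single_mul_single]
  simp

theorem uVar_mul_one_sub (a : R) :
    uVar R * HahnSeries.ofPowerSeries ℤ R (1 - PowerSeries.C a * PowerSeries.X)
      = uVar R - HahnSeries.C a := by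
  rw [map_sub, map_one, map_mul, HahnSeries.ofPowerSeries_C, mul_sub, mul_one, mul_left_comm,
    uVar_mul_ofPowerSeries_X, mul_one]

theorem uVar_sub_mul_invSub (a : R) :
    (uVar R - HahnSeries.C a) * HahnSeries.ofPowerSeries ℤ R (invSub a) = 1 := by
  have h : (1 - PowerSeries.C a * PowerSeries.X) * (PowerSeries.mk fun k => a ^ k) = 1 := by
    ext n
    cases n with
    | zero => simp
    | succ n =>
      rw [sub_mul, one_mul, map_sub, mul_assoc, PowerSeries.coeff_C_mul,
        PowerSeries.coeff_succ_X_mul]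
      simp [PowerSeries.coeff_one, pow_succ']
  rw [← uVar_mul_one_sub, invSub, mul_assoc, ← map_mul, mul_left_comm, h, mul_one,
    uVar_mul_ofPowerSeries_X]

/-- The polynomial `∏_r (1 - z_r t)`, whose value at `t = u⁻¹` is `∏_r (1 - z_r / u)`. -/
def revPoly {ι : Type*} [Fintype ι] (z : ι → R) : Polynomial R :=
  ∏ r, (1 - Polynomial.C (z r) * Polynomial.X)

variable {ι : Type*} [Fintype ι]

/-- `u^m A(u) = ∏_r (u - z_r)` for `A(u) = ∏_r (1 - z_r u⁻¹)`. -/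
theorem uVar_pow_mul_genSeries_revPoly (z : ι → R) :
    uVar R ^ Fintype.card ι * genSeries (revPoly z).coeff = ∏ r, (uVar R - HahnSeries.C (z r)) := by
  have h : PowerSeries.mk (revPoly z).coeff
      = ∏ r, (1 - PowerSeries.C (z r) * PowerSeries.X) := by
    have : PowerSeries.mk (revPoly z).coeff = Polynomial.coeToPowerSeries.ringHom (revPoly z) := by
      ext n; simp
    rw [this, revPoly, map_prod]
    simp
  rw [genSeries, h, map_prod, ← Finset.card_univ, ← Finset.prod_const, ← Finset.prod_mul_distrib]
  exact Finset.prod_congr rfl fun r _ => uVar_mul_one_sub _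

/-- For a polynomial `g`, the shifted series is the value of `g` at `(u - a)⁻¹`. -/
theorem genSeriesShift_coeff (g : Polynomial R) (a : R) :
    genSeriesShift g.coeff a
      = HahnSeries.ofPowerSeries ℤ R (g.eval₂ PowerSeries.C (invSub a)) := by
  rw [genSeriesShift, genSeries]
  congr 1
  ext n
  rw [PowerSeries.coeff_mk, Polynomial.eval₂_eq_sum_range' _ (n := g.natDegree + n + 1) (by omega),
    map_sum]
  simp only [PowerSeries.coeff_C_mul]
  refine Finset.sum_subset (Finset.range_mono (by omega)) fun p _ hp => ?_
  have hp : n < p := by simpa using hp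
  rw [mul_pow, PowerSeries.coeff_X_pow_mul', if_neg (by omega), mul_zero]

/-- `(u - a)^m A(u - a) = ∏_r (u - a - z_r)` for `A(u) = ∏_r (1 - z_r u⁻¹)`. -/
theorem uVar_sub_pow_mul_genSeriesShift_revPoly (z : ι → R) (a : R) :
    (uVar R - HahnSeries.C a) ^ Fintype.card ι * genSeriesShift (revPoly z).coeff a
      = ∏ r, (uVar R - HahnSeries.C (z r + a)) := by
  rw [genSeriesShift_coeff, revPoly, Polynomial.eval₂_finsetProd, map_prod, ← Finset.card_univ,
    ← Finset.prod_const, ← Finset.prod_mul_distrib]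
  refine Finset.prod_congr rfl fun r _ => ?_
  rw [Polynomial.eval₂_sub, Polynomial.eval₂_one, Polynomial.eval₂_mul, Polynomial.eval₂_C,
    Polynomial.eval₂_X, map_sub, map_one, map_mul, HahnSeries.ofPowerSeries_C, mul_sub, mul_one,
    mul_left_comm, uVar_sub_mul_invSub, map_add]
  ring

/-- The coefficientwise action of a ring homomorphism on Laurent series. -/
def mapLaurent {R' : Type*} [CommRing R'] (ψ : R →+* R') :
    LaurentSeries R →+* LaurentSeries R' where
  toFun s := s.map ψ
  map_one' := HahnSeries.map_one ψ.toMonoidWithZeroHom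
  map_mul' x y := HahnSeries.map_mul ψ.toNonUnitalRingHom
  map_zero' := by ext; simp
  map_add' x y := by ext; simp

section Map

variable {R' : Type*} [CommRing R'] (ψ : R →+* R')

@[simp] theorem mapLaurent_coeff (s : LaurentSeries R) (q : ℤ) :
    (mapLaurent ψ s).coeff q = ψ (s.coeff q) := rfl

@[simp] theorem mapLaurent_C (c : R) : mapLaurent ψ (HahnSeries.C c) = HahnSeries.C (ψ c) :=
  HahnSeries.map_C c ψ

@[simp] theorem mapLaurent_uVar : mapLaurent ψ (uVar R) = uVar R' := by
  refine (HahnSeries.map_single (ψ : ZeroHom R R')).trans ?_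
  simp [uVar]

theorem mapLaurent_ofPowerSeries (s : PowerSeries R) :
    mapLaurent ψ (HahnSeries.ofPowerSeries ℤ R s)
      = HahnSeries.ofPowerSeries ℤ R' (PowerSeries.map ψ s) := by
  ext q
  rw [mapLaurent_coeff]
  by_cases hq : 0 ≤ q
  · lift q to ℕ using hq
    rw [HahnSeries.ofPowerSeries_apply_coeff, HahnSeries.ofPowerSeries_apply_coeff,
      PowerSeries.coeff_map]
  · rw [ofPowerSeries_coeff_of_neg s (not_le.1 hq), ofPowerSeries_coeff_of_neg _ (not_le.1 hq),
      map_zero]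

theorem mapLaurent_genSeries (g : ℕ → R) :
    mapLaurent ψ (genSeries g) = genSeries fun n => ψ (g n) := by
  rw [genSeries, mapLaurent_ofPowerSeries, genSeries]
  congr 1

theorem mapLaurent_genSeriesShift (g : ℕ → R) (a : R) :
    mapLaurent ψ (genSeriesShift g a) = genSeriesShift (fun n => ψ (g n)) (ψ a) := by
  have h (n p : ℕ) : ψ (PowerSeries.coeff n ((PowerSeries.X * PowerSeries.mk fun k => a ^ k) ^ p))
      = PowerSeries.coeff n ((PowerSeries.X * PowerSeries.mk fun k => ψ a ^ k) ^ p) := by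
    rw [← PowerSeries.coeff_map, map_pow, map_mul, PowerSeries.map_X]
    congr 3
    ext; simp
  rw [genSeriesShift, mapLaurent_genSeries, genSeriesShift]
  simp only [map_sum, map_mul, h]

end Map

end Laurent

section PartialFractions

variable {K : Type*} [Field K]

theorem uVar_sub_C_ne_zero (a : K) : uVar K - HahnSeries.C a ≠ 0 := (isUnit_uVar_sub a).ne_zero

theorem inv_uVar_sub_C (a : K) : (uVar K - HahnSeries.C a)⁻¹
    = genSeries fun n => if n = 0 then 0 else a ^ (n - 1) := by
  rw [genSeries, ← invSub_eq_mk]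
  exact inv_eq_of_mul_eq_one_right (uVar_sub_mul_invSub a)

theorem uVar_zpow_neg_mul_pow (n : ℕ) : uVar K ^ (-(n : ℤ)) * uVar K ^ n = 1 := by
  rw [zpow_neg, zpow_natCast, inv_mul_cancel₀ (pow_ne_zero _ (isUnit_uVar _).ne_zero)]

theorem C_div_mul_C (a b d x : K) :
    HahnSeries.C a / ((uVar K - HahnSeries.C x) * HahnSeries.C d) * HahnSeries.C b
      = (uVar K - HahnSeries.C x)⁻¹ * HahnSeries.C (a / d * b) := by
  rw [map_mul, map_div₀, div_eq_mul_inv, div_eq_mul_inv, mul_inv]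
  ring

/-- A polynomial in `u` has no terms in negative powers of `u`. -/
theorem coeff_eval₂_uVar (q : Polynomial K) (n : ℕ) :
    (q.eval₂ HahnSeries.C (uVar K)).coeff (n + 1) = 0 := by
  rw [Polynomial.eval₂_eq_sum_range]
  rw [HahnSeries.coeff_sum]
  refine Finset.sum_eq_zero fun p _ => ?_
  rw [uVar, HahnSeries.single_pow, HahnSeries.C_mul_eq_smul, HahnSeries.coeff_smul,
    HahnSeries.coeff_single_of_ne, smul_zero]
  simp only [smul_neg, nsmul_eq_mul, mul_one]
  omega

/-- If `H(u) = N(u) / ∏ᵢ (u - ρᵢ)` with distinct `ρᵢ`, then the coefficient of `u^{-n-1}` in the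
expansion of `H(u)` is the sum over `i` of the residues of `u^n H(u)` at `ρᵢ`. -/
theorem coeff_of_mul_prod_eq {ι : Type*} [Fintype ι] [DecidableEq ι] {ρ : ι → K}
    (hρ : Function.Injective ρ) (N : Polynomial K) (H : LaurentSeries K)
    (hH : H * ∏ i, (uVar K - HahnSeries.C (ρ i)) = N.eval₂ HahnSeries.C (uVar K)) (n : ℕ) :
    H.coeff (n + 1) = ∑ i, N.eval (ρ i) / (∏ j ∈ Finset.univ.erase i, (ρ i - ρ j)) * ρ i ^ n := by
  obtain ⟨q, r, hr, hN⟩ := Polynomial.eq_quo_mul_prod_add_sum_rem_mul_prod (s := Finset.univ) N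
    (g := fun i => Polynomial.X - Polynomial.C (ρ i)) (fun i _ => Polynomial.monic_X_sub_C _)
    (fun i _ j _ hij => Polynomial.isCoprime_X_sub_C_of_isUnit_sub
      (sub_ne_zero.2 (hρ.ne hij)).isUnit)
  -- The numerators `r i` of the partial fractions are constants, namely the residues.
  have hrC (i : ι) : r i = Polynomial.C ((r i).coeff 0) := by
    refine Polynomial.eq_C_of_degree_le_zero ?_
    have := hr i (Finset.mem_univ i)
    rw [Polynomial.degree_X_sub_C] at this
    exact Nat.WithBot.lt_one_iff_le_zero.1 this
  have hne (i : ι) : ∏ j ∈ Finset.univ.erase i, (ρ i - ρ j) ≠ 0 :=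
    Finset.prod_ne_zero_iff.2 fun j hj => sub_ne_zero.2 (hρ.ne (Finset.ne_of_mem_erase hj).symm)
  have hval (i : ι) :
      N.eval (ρ i) / ∏ j ∈ Finset.univ.erase i, (ρ i - ρ j) = (r i).coeff 0 := by
    rw [div_eq_iff (hne i), hN, Polynomial.eval_add, Polynomial.eval_mul, Polynomial.eval_finsetSum,
      Polynomial.eval_prod, Finset.prod_eq_zero (Finset.mem_univ i) (by simp), mul_zero, zero_add,
      Finset.sum_eq_single i]
    · rw [Polynomial.eval_mul, Polynomial.eval_prod]
      conv_lhs => rw [hrC i]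
      simp
    · intro j _ hji
      rw [Polynomial.eval_mul, Polynomial.eval_prod, Finset.prod_eq_zero (i := i), mul_zero]
      · simp [hji.symm]
      · simp
    · simp
  have hu : ∏ i, (uVar K - HahnSeries.C (ρ i)) ≠ 0 :=
    Finset.prod_ne_zero_iff.2 fun i _ => uVar_sub_C_ne_zero _
  have hsum : H = q.eval₂ HahnSeries.C (uVar K)
      + ∑ i, (uVar K - HahnSeries.C (ρ i))⁻¹ * HahnSeries.C ((r i).coeff 0) := by
    refine mul_right_cancel₀ hu ?_
    rw [hH, hN, Polynomial.eval₂_add, Polynomial.eval₂_mul, Polynomial.eval₂_finsetProd,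
      Polynomial.eval₂_finsetSum, add_mul, Finset.sum_mul]
    congr 1
    · simp
    · refine Finset.sum_congr rfl fun i _ => ?_
      rw [← Finset.mul_prod_erase _ _ (Finset.mem_univ i), Polynomial.eval₂_mul,
        Polynomial.eval₂_finsetProd, hrC i]
      have := uVar_sub_C_ne_zero (ρ i)
      simp only [Polynomial.eval₂_C, Polynomial.eval₂_sub, Polynomial.eval₂_X,
        Polynomial.coeff_C_zero]
      field_simp
  rw [hsum, HahnSeries.coeff_add, coeff_eval₂_uVar, zero_add, HahnSeries.coeff_sum]
  refine Finset.sum_congr rfl fun i _ => ?_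
  rw [hval, inv_uVar_sub_C, genSeries_mul_C, ← Nat.cast_succ, genSeries_coeff_natCast]
  simp [mul_comm]

end PartialFractions

/-! ### The difference operators on the field of rational functions -/

namespace Datum

variable {I : Type*} [Fintype I] (D : Datum I)

/-- The field of fractions of `P`. -/
abbrev K := FractionRing D.P

/-- The variable `z_v` as a rational function. -/
def zK (v : D.Var) : D.K := algebraMap D.P D.K (MvPolynomial.X v)

/-- The automorphism of the field of fractions of `P` with `z_w ↦ z_w + 2h δ_{vw}`, for `h = ±1`:
`β_v` if `h = 1`, and `β_v⁻¹` otherwise. -/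
def shiftK (h : ℤ) (v : D.Var) : D.K ≃ₐ[ℂ] D.K :=
  fracEquiv (if h = 1 then beta ℂ v else (beta ℂ v).symm)

variable {D}

theorem shiftK_zK {h : ℤ} (hh : h = 1 ∨ h = -1) (v w : D.Var) :
    D.shiftK h v (D.zK w) = D.zK w + if w = v then 2 * (h : D.K) else 0 := by
  have h2 : algebraMap D.P D.K 2 = 2 := map_ofNat _ 2
  rcases hh with rfl | rfl
  · simp only [shiftK, zK, if_true, fracEquiv_algebraMap, beta_X, map_add]
    split_ifs <;> simp [h2]
  · simp only [shiftK, zK, if_neg (by norm_num : ¬ (-1 : ℤ) = 1), fracEquiv_algebraMap,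
      beta_symm_X, map_sub]
    split_ifs <;> simp [sub_eq_add_neg, h2]

theorem shiftK_zK_of_ne {h : ℤ} (hh : h = 1 ∨ h = -1) {v w : D.Var} (hvw : w ≠ v) :
    D.shiftK h v (D.zK w) = D.zK w := by
  rw [shiftK_zK hh, if_neg hvw, add_zero]

theorem shiftK_zK_self {h : ℤ} (hh : h = 1 ∨ h = -1) (v : D.Var) :
    D.shiftK h v (D.zK v) = D.zK v + 2 * h := by
  rw [shiftK_zK hh, if_pos rfl]

theorem shiftK_comm {h h' : ℤ} (v w : D.Var) (f : D.K) :
    D.shiftK h v (D.shiftK h' w f) = D.shiftK h' w (D.shiftK h v f) := by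
  have h1 (f : D.P) : beta ℂ v ((beta ℂ w).symm f) = (beta ℂ w).symm (beta ℂ v f) := by
    rw [AlgEquiv.eq_symm_apply, ← beta_comm, AlgEquiv.apply_symm_apply]
  have h2 (f : D.P) : beta ℂ w ((beta ℂ v).symm f) = (beta ℂ v).symm (beta ℂ w f) := by
    rw [AlgEquiv.eq_symm_apply, ← beta_comm, AlgEquiv.apply_symm_apply]
  refine fracEquiv_comm (fun f => ?_) f
  split_ifs
  · exact beta_comm v w f
  · exact h1 f
  · exact (h2 f).symm
  · rw [AlgEquiv.symm_apply_eq, h1, AlgEquiv.apply_symm_apply]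

theorem shiftK_neg_shiftK {h : ℤ} (hh : h = 1 ∨ h = -1) (v : D.Var) (f : D.K) :
    D.shiftK (-h) v (D.shiftK h v f) = f := by
  obtain ⟨x, y, -, rfl⟩ := IsFractionRing.div_surjective (A := D.P) f
  rcases hh with rfl | rfl <;> simp [shiftK]

/-- Distinct variables do not differ by a constant. -/
theorem zK_sub_zK_add_ne_zero {v w : D.Var} (hvw : v ≠ w) (c : ℂ) :
    D.zK v - D.zK w + algebraMap ℂ D.K c ≠ 0 := by
  have : D.zK v - D.zK w + algebraMap ℂ D.K c
      = algebraMap D.P D.K (MvPolynomial.X v - MvPolynomial.X w + MvPolynomial.C c) := by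
    rw [map_add, map_sub, ← MvPolynomial.algebraMap_eq, ← IsScalarTower.algebraMap_apply]
    rfl
  rw [this]
  refine (map_ne_zero_iff _ (IsFractionRing.injective D.P D.K)).2 fun h => ?_
  have := congrArg (MvPolynomial.eval fun u => if u = v then 1 - c else 0) h
  simp [hvw.symm] at this

theorem zK_sub_zK_add_intCast_ne_zero {v w : D.Var} (hvw : v ≠ w) (n : ℤ) :
    D.zK v - D.zK w + n ≠ 0 := by
  simpa using zK_sub_zK_add_ne_zero hvw (n : ℂ)

theorem zK_injective : Function.Injective D.zK := fun v w h => by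
  by_contra hvw
  exact zK_sub_zK_add_intCast_ne_zero hvw 0 (by simp [h])

variable (D)

/-- The coefficient `∏_j ∏_s (z_{i,r} - z_{j,s} + h) / ∏_{s ≠ r} (z_{i,r} - z_{i,s})` at
`v = (i, r)`, where `j` runs over the vertices with `dir i j`. -/
def ptCoef (dir : I → I → Prop) (h : ℤ) (v : D.Var) : D.K :=
  (∏ j ∈ Finset.univ.filter (dir v.1), ∏ s, (D.zK v - D.zK ⟨j, s⟩ + h))
    / ∏ s ∈ Finset.univ.erase v.2, (D.zK v - D.zK ⟨v.1, s⟩)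

/-- The factor of `ptCoef` at `v` in which the variable `z_u` occurs. The two conditions exclude
each other if no vertex is in relation `dir` to itself. -/
def ptFactor (dir : I → I → Prop) (h : ℤ) (v u : D.Var) : D.K :=
  (if u.1 = v.1 ∧ u ≠ v then (D.zK v - D.zK u)⁻¹ else 1)
    * (if dir v.1 u.1 then D.zK v - D.zK u + h else 1)

variable {D} {dir : I → I → Prop}

theorem ptCoef_eq_prod (h : ℤ) (v : D.Var) :
    D.ptCoef dir h v = ∏ u, D.ptFactor dir h v u := by
  obtain ⟨i, r⟩ := v
  simp only [ptFactor, Finset.prod_mul_distrib]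
  rw [ptCoef, div_eq_inv_mul]
  congr 1
  · rw [Fintype.prod_sigma, Finset.prod_eq_single i]
    · rw [← Finset.prod_inv_distrib, ← Finset.filter_ne' Finset.univ r, Finset.prod_filter]
      simp
    · intro j _ hj
      simp [hj]
    · simp
  · rw [Fintype.prod_sigma, Finset.prod_filter]
    refine Finset.prod_congr rfl fun j _ => ?_
    by_cases hj : dir i j <;> simp [hj]

theorem ptFactor_ne_zero (hdir : ∀ i, ¬ dir i i) (h : ℤ) (v u : D.Var) :
    D.ptFactor dir h v u ≠ 0 := by
  by_cases huv : u = v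
  · subst huv
    simp [ptFactor, hdir]
  · have h1 := zK_sub_zK_add_intCast_ne_zero (Ne.symm huv) h
    have h2 := sub_ne_zero.2 (zK_injective.ne (Ne.symm huv))
    rw [ptFactor]
    refine mul_ne_zero ?_ ?_ <;> split_ifs <;> simp [h1, h2]

/-- A shift of the variable `z_v` changes the coefficient at another point `w` by a single
factor. -/
theorem shiftK_ptCoef (hdir : ∀ i, ¬ dir i i) {g : ℤ} (hg : g = 1 ∨ g = -1) (h : ℤ) {v w : D.Var}
    (hvw : w ≠ v) :
    D.shiftK g v (D.ptCoef dir h w) = D.ptCoef dir h w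
      * (D.shiftK g v (D.ptFactor dir h w v) / D.ptFactor dir h w v) := by
  rw [ptCoef_eq_prod, ← Finset.mul_prod_erase _ _ (Finset.mem_univ v), map_mul, map_prod,
    Finset.prod_congr rfl (g := D.ptFactor dir h w)]
  · have := ptFactor_ne_zero (D := D) hdir h w v
    field_simp
  · intro u hu
    have huv : u ≠ v := Finset.ne_of_mem_erase hu
    simp only [ptFactor, map_mul, apply_ite (D.shiftK g v), map_inv₀, map_add, map_sub, map_one,
      map_intCast, shiftK_zK_of_ne hg hvw, shiftK_zK_of_ne hg huv]

/-- The relation `dir` is an orientation of the edges of the graph. -/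
structure IsOrientation (D : Datum I) (dir : I → I → Prop) : Prop where
  adj_iff : ∀ i j, D.graph.Adj i j ↔ dir i j ∨ dir j i
  asymm : ∀ i j, dir i j → ¬ dir j i

theorem IsOrientation.irrefl (H : D.IsOrientation dir) (i : I) : ¬ dir i i :=
  fun h => H.asymm i i h h

theorem IsOrientation.swap (H : D.IsOrientation dir) : D.IsOrientation fun i j => dir j i where
  adj_iff i j := (H.adj_iff i j).trans or_comm
  asymm i j h h' := H.asymm i j h' h

theorem isOrientation_arrow : D.IsOrientation D.Arrow where
  adj_iff i j := by
    refine ⟨fun h => ?_, ?_⟩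
    · have := D.bipartite i j h
      have h' := h.symm
      unfold Arrow
      tauto
    · rintro (h | h)
      exacts [h.1, h.1.symm]
  asymm i j h h' := h.2.1 h'.2.2

/-- The exchange relations hold for the coefficients `ptCoef` of any orientation: both sides are the
product of the coefficients at `v` and `w` with a rational function of `z_v - z_w`. The factor `κ`
and the constant `c` accommodate the polynomial `p_i` and the points `z + 2` of the currents
`F_i(u)`. -/
theorem shiftFamily_ptCoef (H : D.IsOrientation dir) {h : ℤ} (hh : h = 1 ∨ h = -1)
    {κ : D.Var → D.K} (hκ : ∀ v w, v ≠ w → D.shiftK h v (κ w) = κ w) (c : ℤ) :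
    ShiftFamily D h (fun v => κ v * D.ptCoef dir h v) (fun v => D.zK v + c) (D.shiftK h) where
  comm := shiftK_comm
  self v := by rw [map_add, map_intCast, shiftK_zK_self hh]; ring
  other v w hvw := by rw [map_add, map_intCast, shiftK_zK_of_ne hh hvw.symm]
  generic v w hvw n := by simpa using zK_sub_zK_add_intCast_ne_zero hvw n
  exchange v w hvw := by
    have key : (D.zK v - D.zK w + h * dot D.graph v.1 w.1)
          * (D.shiftK h v (D.ptFactor dir h w v) / D.ptFactor dir h w v)
        = (D.zK v - D.zK w - h * dot D.graph v.1 w.1)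
          * (D.shiftK h w (D.ptFactor dir h v w) / D.ptFactor dir h v w) := by
      have n1 := zK_sub_zK_add_intCast_ne_zero hvw h
      have n2 := zK_sub_zK_add_intCast_ne_zero hvw.symm h
      have n3 : D.zK v - (D.zK w + 2 * h) ≠ 0 := by
        convert zK_sub_zK_add_intCast_ne_zero hvw (-2 * h) using 1
        push_cast; ring
      have n4 : D.zK w - (D.zK v + 2 * h) ≠ 0 := by
        convert zK_sub_zK_add_intCast_ne_zero hvw.symm (-2 * h) using 1
        push_cast; ring
      simp only [ptFactor, map_mul, apply_ite (D.shiftK h v), apply_ite (D.shiftK h w), map_inv₀,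
        map_add, map_sub, map_one, map_intCast, shiftK_zK_of_ne hh hvw,
        shiftK_zK_of_ne hh hvw.symm, shiftK_zK_self hh]
      by_cases hij : v.1 = w.1
      · have hirr := H.irrefl
        simp only [hij, hvw, hvw.symm, hirr, dot, if_true, if_false, ne_eq, not_false_eq_true,
          and_self, mul_one, Int.cast_ofNat]
        rw [inv_div_inv, inv_div_inv, ← mul_div_assoc, ← mul_div_assoc, div_eq_div_iff n4 n3]
        ring
      · by_cases h1 : dir v.1 w.1
        · have h2 := H.asymm _ _ h1
          have h3 := (H.adj_iff _ _).2 (Or.inl h1)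
          simp only [hij, Ne.symm hij, h1, h2, h3, dot, if_true, if_false, false_and, one_mul]
          field_simp
          push_cast
          ring
        · by_cases h2 : dir w.1 v.1
          · have h3 := (H.adj_iff _ _).2 (Or.inr h2)
            simp only [hij, Ne.symm hij, h1, h2, h3, dot, if_true, if_false, false_and, one_mul]
            field_simp
            push_cast
            ring
          · have h3 : ¬ D.graph.Adj v.1 w.1 := fun h => ((H.adj_iff _ _).1 h).elim h1 h2
            simp [hij, Ne.symm hij, h1, h2, h3, dot]
    simp only [map_mul, hκ v w hvw, hκ w v hvw.symm, shiftK_ptCoef H.irrefl hh h hvw,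
      shiftK_ptCoef H.irrefl hh h hvw.symm]
    linear_combination (κ v * D.ptCoef dir h v * κ w * D.ptCoef dir h w) * key

end Datum

/-! ### The currents and their relations -/

theorem symBracket_of_eq_one {B : Type*} [Ring B] (X : ℕ+ → B) (y : B) {N : ℕ} (hN : N = 1)
    (p : Fin N → ℕ+) : ∃ a, Datum.symBracket X y p = ⁅X a, y⁆ := by
  subst hN
  refine ⟨p 0, ?_⟩
  simp [Datum.symBracket, Datum.iterBracket, List.ofFn_succ]

theorem symBracket_of_eq_two {B : Type*} [Ring B] (X : ℕ+ → B) (y : B) {N : ℕ} (hN : N = 2)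
    (p : Fin N → ℕ+) :
    ∃ a b, Datum.symBracket X y p = ⁅X a, ⁅X b, y⁆⁆ + ⁅X b, ⁅X a, y⁆⁆ := by
  subst hN
  refine ⟨p 0, p 1, ?_⟩
  have h : (Finset.univ : Finset (Equiv.Perm (Fin 2))) = {1, Equiv.swap 0 1} := by decide
  have h' : (1 : Equiv.Perm (Fin 2)) ≠ Equiv.swap 0 1 := by decide
  rw [Datum.symBracket, h, Finset.sum_pair h']
  simp [Datum.iterBracket, List.ofFn_succ]

namespace Datum

variable {I : Type*} [Fintype I] (D : Datum I)

/-- The coefficient of `β_{i,r}⁻¹` in the action of `E_i^{(1)}`. -/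
def coefE (v : D.Var) : D.K := -1 * D.ptCoef (fun i j => D.Arrow j i) (-1) v

/-- The coefficient of `β_{i,r}` in the action of `F_i^{(1)}`. -/
def coefF (v : D.Var) : D.K :=
  Polynomial.aeval (D.zK v + 2) (D.pPoly v.1) * D.ptCoef D.Arrow 1 v

/-- The coefficient of `u^{-p}` in `u^{-m_i} W_i(u)`. -/
def coefA (i : I) (p : ℕ) : D.K := (revPoly fun r => D.zK ⟨i, r⟩).coeff p

/-- The action of `E_i^{(p+1)}` on rational functions. -/
def opE (i : I) (p : ℕ) : Module.End ℂ D.K := D.shiftSum D.coefE D.zK (D.shiftK (-1)) i p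

/-- The action of `F_i^{(p+1)}` on rational functions. -/
def opF (i : I) (p : ℕ) : Module.End ℂ D.K :=
  D.shiftSum D.coefF (fun v => D.zK v + 2) (D.shiftK 1) i p

theorem shiftFamily_coefE : ShiftFamily D (-1) D.coefE D.zK (D.shiftK (-1)) := by
  have := shiftFamily_ptCoef (D := D) isOrientation_arrow.swap (Or.inr rfl)
    (κ := fun _ => -1) (by simp) 0
  simp only [Int.cast_zero, add_zero] at this
  exact this

theorem shiftK_aeval_pPoly {h : ℤ} (hh : h = 1 ∨ h = -1) {v w : D.Var} (hvw : v ≠ w) (i : I) :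
    D.shiftK h v (Polynomial.aeval (D.zK w + 2) (D.pPoly i))
      = Polynomial.aeval (D.zK w + 2) (D.pPoly i) := by
  rw [← Polynomial.aeval_algHom_apply, map_add, shiftK_zK_of_ne hh hvw.symm, map_ofNat]

theorem shiftFamily_coefF :
    ShiftFamily D 1 D.coefF (fun v => D.zK v + 2) (D.shiftK 1) := by
  have := shiftFamily_ptCoef (D := D) isOrientation_arrow (Or.inl rfl)
    (κ := fun v => Polynomial.aeval (D.zK v + 2) (D.pPoly v.1))
    (fun v w hvw => D.shiftK_aeval_pPoly (Or.inl rfl) hvw _) 2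
  simp only [Int.cast_ofNat] at this
  exact this

variable {D}

/-- The exchange relation between `E` and `F`, by which only the diagonal terms contribute to their
commutator. -/
theorem coefE_mul_shiftK_coefF {v w : D.Var} (hvw : v ≠ w) :
    D.coefE v * D.shiftK (-1) v (D.coefF w) = D.coefF w * D.shiftK 1 w (D.coefE v) := by
  have key : D.shiftK (-1) v (D.ptFactor D.Arrow 1 w v) / D.ptFactor D.Arrow 1 w v
      = D.shiftK 1 w (D.ptFactor (fun i j => D.Arrow j i) (-1) v w)
        / D.ptFactor (fun i j => D.Arrow j i) (-1) v w := by
    simp only [ptFactor, map_mul, apply_ite (D.shiftK (-1) v), apply_ite (D.shiftK 1 w), map_inv₀,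
      map_add, map_sub, map_one, map_intCast, shiftK_zK_of_ne (Or.inr rfl) hvw.symm,
      shiftK_zK_of_ne (Or.inl rfl) hvw, shiftK_zK_self (D := D) (Or.inr rfl),
      shiftK_zK_self (D := D) (Or.inl rfl)]
    have hirr := (isOrientation_arrow (D := D)).irrefl
    by_cases hij : v.1 = w.1
    · simp only [hij, hvw, hvw.symm, hirr, if_true, if_false, ne_eq, not_false_eq_true,
        and_self, mul_one, inv_div_inv]
      rw [← neg_div_neg_eq]
      congr 1
      · ring
      · push_cast; ring
    · simp only [hij, Ne.symm hij, if_false, false_and, one_mul]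
      split_ifs
      · rw [← neg_div_neg_eq]
        congr 1 <;> (push_cast; ring)
      · rfl
  rw [coefE, coefF, map_mul, map_mul, D.shiftK_aeval_pPoly (Or.inr rfl) hvw, map_neg, map_one,
    shiftK_ptCoef isOrientation_arrow.irrefl (Or.inr rfl) _ hvw.symm,
    shiftK_ptCoef (dir := fun i j => D.Arrow j i) isOrientation_arrow.swap.irrefl (Or.inl rfl) _
      hvw, key]
  ring

theorem revPoly_shift {ι R : Type*} [Fintype ι] [DecidableEq ι] [CommRing R] (z : ι → R) (r : ι)
    (a : R) :
    (1 - Polynomial.C (z r) * Polynomial.X) * revPoly (Function.update z r a)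
      = (1 - Polynomial.C a * Polynomial.X) * revPoly z := by
  rw [revPoly, revPoly, ← Finset.mul_prod_erase _ _ (Finset.mem_univ r),
    ← Finset.mul_prod_erase _ (fun s => 1 - Polynomial.C (z s) * Polynomial.X)
      (Finset.mem_univ r), Finset.prod_congr rfl
      (g := fun s => 1 - Polynomial.C (z s) * Polynomial.X) (s₂ := Finset.univ.erase r)]
  · simp only [Function.update_self]
    ring
  · intro s hs
    rw [Function.update_of_ne (Finset.ne_of_mem_erase hs)]

theorem map_coeff_revPoly {ι R R' : Type*} [Fintype ι] [CommRing R] [CommRing R'] (φ : R →+* R')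
    (z : ι → R) (p : ℕ) : φ ((revPoly z).coeff p) = (revPoly fun r => φ (z r)).coeff p := by
  rw [← Polynomial.coeff_map, revPoly, Polynomial.map_prod]
  simp [revPoly]

theorem shiftK_coefA_of_ne {h : ℤ} (hh : h = 1 ∨ h = -1) {v : D.Var} {i : I} (hi : v.1 ≠ i)
    (p : ℕ) :
    D.shiftK h v (D.coefA i p) = D.coefA i p := by
  refine (map_coeff_revPoly (D.shiftK h v : D.K →+* D.K) _ p).trans ?_
  rw [coefA]
  congr 2
  funext r
  exact shiftK_zK_of_ne hh fun h => hi (congrArg Sigma.fst h).symm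

/-- The effect of a shift `σ` of `z_{i,r}` on `A_i(u)`, read off from
`(u - z_{i,r}) (σ A_i)(u) = (u - z_{i,r} - 2h) A_i(u)`. -/
theorem shiftK_coefA {h : ℤ} (hh : h = 1 ∨ h = -1) (i : I) (r : Fin (D.m i)) (p : ℕ) :
    D.shiftK h ⟨i, r⟩ (D.coefA i (p + 1)) - D.zK ⟨i, r⟩ * D.shiftK h ⟨i, r⟩ (D.coefA i p)
      = D.coefA i (p + 1) - (D.zK ⟨i, r⟩ + 2 * h) * D.coefA i p := by
  have h1 (p : ℕ) : D.shiftK h ⟨i, r⟩ (D.coefA i p) = (revPoly (Function.update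
      (fun r => D.zK ⟨i, r⟩) r (D.zK ⟨i, r⟩ + 2 * h))).coeff p := by
    refine (map_coeff_revPoly (D.shiftK h ⟨i, r⟩ : D.K →+* D.K) _ p).trans ?_
    congr 2
    funext s
    by_cases hs : s = r
    · subst hs
      simpa using shiftK_zK_self hh _
    · rw [Function.update_of_ne hs]
      exact shiftK_zK_of_ne hh (by simpa using hs)
  have h2 := congrArg (fun q => Polynomial.coeff q (p + 1))
    (revPoly_shift (fun r => D.zK ⟨i, r⟩) r (D.zK ⟨i, r⟩ + 2 * (h : D.K)))
  simp only [sub_mul, one_mul, mul_assoc, Polynomial.coeff_sub, Polynomial.coeff_C_mul,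
    Polynomial.coeff_X_mul, ← h1] at h2
  exact h2

theorem opE_coefA (i j : I) (p q : ℕ) :
    ⁅LinearMap.mulLeft ℂ (D.coefA i (p + 1)), D.opE j q⁆
      - ⁅LinearMap.mulLeft ℂ (D.coefA i p), D.opE j (q + 1)⁆
      = if i = j then -(2 * (LinearMap.mulLeft ℂ (D.coefA i p) * D.opE j q)) else 0 := by
  simp only [opE, shiftSum, bracket_sum, ← Finset.sum_sub_distrib, Finset.mul_sum, two_mul,
    ← Finset.sum_neg_distrib]
  split_ifs with hij
  · subst hij
    refine Finset.sum_congr rfl fun r _ => LinearMap.ext fun f => ?_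
    have := shiftK_coefA (D := D) (Or.inr rfl) i r p
    simp only [Ring.lie_def, LinearMap.sub_apply, Module.End.mul_apply, LinearMap.mulLeft_apply,
      shiftTerm_apply, map_mul, LinearMap.neg_apply, LinearMap.add_apply]
    push_cast at this
    linear_combination (-(D.coefE ⟨i, r⟩) * D.zK ⟨i, r⟩ ^ q * D.shiftK (-1) ⟨i, r⟩ f) * this
  · refine Finset.sum_eq_zero fun r _ => LinearMap.ext fun f => ?_
    simp only [Ring.lie_def, LinearMap.sub_apply, Module.End.mul_apply, LinearMap.mulLeft_apply,
      shiftTerm_apply, map_mul, shiftK_coefA_of_ne (Or.inr rfl) (v := ⟨j, r⟩) (Ne.symm hij),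
      LinearMap.zero_apply]
    ring

theorem opF_coefA (i j : I) (p q : ℕ) :
    ⁅LinearMap.mulLeft ℂ (D.coefA i (p + 1)), D.opF j q⁆
      - ⁅LinearMap.mulLeft ℂ (D.coefA i p), D.opF j (q + 1)⁆
      = if i = j then 2 * (D.opF j q * LinearMap.mulLeft ℂ (D.coefA i p)) else 0 := by
  simp only [opF, shiftSum, bracket_sum, ← Finset.sum_sub_distrib, Finset.sum_mul, two_mul,
    ← Finset.sum_add_distrib]
  split_ifs with hij
  · subst hij
    refine Finset.sum_congr rfl fun r _ => LinearMap.ext fun f => ?_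
    have := shiftK_coefA (D := D) (Or.inl rfl) i r p
    simp only [Ring.lie_def, LinearMap.sub_apply, Module.End.mul_apply, LinearMap.mulLeft_apply,
      shiftTerm_apply, map_mul, LinearMap.add_apply]
    push_cast at this
    linear_combination (-(D.coefF ⟨i, r⟩) * (D.zK ⟨i, r⟩ + 2) ^ q * D.shiftK 1 ⟨i, r⟩ f) * this
  · refine Finset.sum_eq_zero fun r _ => LinearMap.ext fun f => ?_
    simp only [Ring.lie_def, LinearMap.sub_apply, Module.End.mul_apply, LinearMap.mulLeft_apply,
      shiftTerm_apply, map_mul, shiftK_coefA_of_ne (Or.inl rfl) (v := ⟨j, r⟩) (Ne.symm hij),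
      LinearMap.zero_apply]
    ring

theorem opE_opF_of_ne {i j : I} (hij : i ≠ j) (p q : ℕ) : ⁅D.opE i p, D.opF j q⁆ = 0 := by
  simp only [opE, opF, shiftSum, sum_bracket, bracket_sum]
  refine Finset.sum_eq_zero fun s _ => Finset.sum_eq_zero fun r _ => ?_
  have hvw : (⟨i, r⟩ : D.Var) ≠ ⟨j, s⟩ := fun h => hij (congrArg Sigma.fst h)
  refine shiftTerm_commute (shiftK_comm _ _) ?_ (shiftK_zK_of_ne (Or.inl rfl) hvw)
    (coefE_mul_shiftK_coefF hvw) p q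
  rw [map_add, shiftK_zK_of_ne (Or.inr rfl) hvw.symm, map_ofNat]

/-- The shifts in the diagonal terms cancel, so `[E_i^{(p+1)}, F_i^{(q+1)}]` is a multiplication
operator. -/
theorem opE_opF (i : I) (p q : ℕ) :
    ⁅D.opE i p, D.opF i q⁆ = LinearMap.mulLeft ℂ (∑ r : Fin (D.m i),
      (D.coefE ⟨i, r⟩ * D.shiftK (-1) ⟨i, r⟩ (D.coefF ⟨i, r⟩) * D.zK ⟨i, r⟩ ^ (p + q)
        - D.coefF ⟨i, r⟩ * D.shiftK 1 ⟨i, r⟩ (D.coefE ⟨i, r⟩) * (D.zK ⟨i, r⟩ + 2) ^ (p + q))) := by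
  simp only [opE, opF, shiftSum, sum_bracket, bracket_sum]
  rw [Finset.sum_comm]
  have : ∀ r : Fin (D.m i), ∑ s : Fin (D.m i),
      ⁅shiftTerm (D.coefE ⟨i, r⟩) (D.zK ⟨i, r⟩) (D.shiftK (-1) ⟨i, r⟩) p,
        shiftTerm (D.coefF ⟨i, s⟩) (D.zK ⟨i, s⟩ + 2) (D.shiftK 1 ⟨i, s⟩) q⁆ =
      LinearMap.mulLeft ℂ (D.coefE ⟨i, r⟩ * D.shiftK (-1) ⟨i, r⟩ (D.coefF ⟨i, r⟩)
          * D.zK ⟨i, r⟩ ^ (p + q)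
        - D.coefF ⟨i, r⟩ * D.shiftK 1 ⟨i, r⟩ (D.coefE ⟨i, r⟩)
          * (D.zK ⟨i, r⟩ + 2) ^ (p + q)) := by
    intro r
    rw [Finset.sum_eq_single r]
    · ext f
      have h1 := shiftK_neg_shiftK (D := D) (Or.inl rfl) ⟨i, r⟩ f
      have h2 := shiftK_neg_shiftK (D := D) (Or.inr rfl) ⟨i, r⟩ f
      rw [neg_neg] at h2
      simp only [Ring.lie_def, LinearMap.sub_apply, Module.End.mul_apply, LinearMap.mulLeft_apply,
        shiftTerm_apply, map_mul, map_pow, map_add, map_ofNat, h1, h2,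
        shiftK_zK_self (D := D) (Or.inl rfl), shiftK_zK_self (D := D) (Or.inr rfl)]
      push_cast
      ring
    · intro s _ hs
      have hvw : (⟨i, r⟩ : D.Var) ≠ ⟨i, s⟩ := by simpa using hs.symm
      refine shiftTerm_commute (shiftK_comm _ _) ?_ (shiftK_zK_of_ne (Or.inl rfl) hvw)
        (coefE_mul_shiftK_coefF hvw) p q
      rw [map_add, shiftK_zK_of_ne (Or.inr rfl) hvw.symm, map_ofNat]
    · simp
  rw [Finset.sum_congr rfl fun r _ => this r]
  ext f
  simp only [LinearMap.sum_apply, LinearMap.mulLeft_apply, Finset.sum_mul]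

end Datum

/-! ### The commutator of `E` and `F` -/

namespace Datum

variable {I : Type*} [Fintype I] (D : Datum I)

/-- The evaluation of commutative polynomials in the `A_i^{(q)}` at the coefficients of
`u^{-m_i} W_i(u)`. -/
def evalA : CPoly I →ₐ[ℂ] D.K := MvPolynomial.aeval fun v => D.coefA v.1 v.2

/-- The numerator `p_i(u) ∏_{j ∼ i} W_j(u - 1)` of the image of `H_i(u)`. -/
def hNum (i : I) : Polynomial D.K :=
  (D.pPoly i).map (algebraMap ℂ D.K)
    * ∏ j ∈ D.nbrs i, ∏ s, (Polynomial.X - Polynomial.C (D.zK ⟨j, s⟩ + 1))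

/-- The poles `z_{i,r}` and `z_{i,r} + 2` of the image of `H_i(u)`. -/
def hPole (i : I) : Fin (D.m i) ⊕ Fin (D.m i) → D.K :=
  Sum.elim (fun r => D.zK ⟨i, r⟩) (fun r => D.zK ⟨i, r⟩ + 2)

variable {D}

theorem coefA_zero (i : I) : D.coefA i 0 = 1 := by
  rw [coefA, revPoly, Polynomial.coeff_zero_prod]
  simp

theorem evalA_cA (i : I) (p : ℕ) : D.evalA (cA i p) = D.coefA i p := by
  rw [cA]
  split_ifs with h
  · simp [evalA]
  · obtain rfl : p = 0 := by omega
    rw [map_one, coefA_zero]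

theorem hPole_injective (i : I) : Function.Injective (D.hPole i) := by
  have h1 {r s : Fin (D.m i)} (h : D.zK ⟨i, r⟩ = D.zK ⟨i, s⟩) : r = s := by
    simpa using zK_injective h
  have h2 (r s : Fin (D.m i)) : D.zK ⟨i, r⟩ ≠ D.zK ⟨i, s⟩ + 2 := by
    intro h
    by_cases hrs : r = s
    · subst hrs
      simp at h
    · refine zK_sub_zK_add_intCast_ne_zero (D := D) (v := ⟨i, r⟩) (w := ⟨i, s⟩) (by simpa using hrs)
        (-2) ?_
      rw [h]; push_cast; ring
  rintro (r | r) (s | s) h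
  · exact congrArg _ (h1 h)
  · exact absurd h (h2 r s)
  · exact absurd h.symm (h2 s r)
  · exact congrArg _ (h1 (add_right_cancel h))

/-- The image of `H_i(u)` is the rational function
`p_i(u) ∏_{j ∼ i} W_j(u - 1) / (W_i(u) W_i(u - 2))`. -/
theorem mapLaurent_hSeries_mul (i : I) :
    mapLaurent (D.evalA : CPoly I →+* D.K) (D.hSeries i)
        * ∏ k, (uVar D.K - HahnSeries.C (D.hPole i k))
      = (D.hNum i).eval₂ HahnSeries.C (uVar D.K) := by
  have hA (j : I) : (fun p => (D.evalA : CPoly I →+* D.K) (cA j p))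
      = (revPoly fun r => D.zK ⟨j, r⟩).coeff := funext fun p => evalA_cA j p
  have hC : (2 : LaurentSeries D.K) = HahnSeries.C (2 : D.K) := (map_ofNat _ 2).symm
  have hden : mapLaurent (D.evalA : CPoly I →+* D.K) (D.hDenom i)
      = ∏ k, (uVar D.K - HahnSeries.C (D.hPole i k)) := by
    have h1 := uVar_pow_mul_genSeries_revPoly fun r => D.zK ⟨i, r⟩
    have h2 := uVar_sub_pow_mul_genSeriesShift_revPoly (fun r => D.zK ⟨i, r⟩) 2
    rw [Fintype.card_fin] at h1 h2
    rw [hDenom]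
    simp only [map_mul, map_pow, map_sub, mapLaurent_uVar, mapLaurent_genSeries,
      mapLaurent_genSeriesShift, hA, map_ofNat]
    rw [Fintype.prod_sum_type, mul_mul_mul_comm, h1, hC, h2]
    rfl
  have hnum : mapLaurent (D.evalA : CPoly I →+* D.K)
      ((D.pPoly i).eval₂ (HahnSeries.C.comp MvPolynomial.C) (uVar (CPoly I))
        * (∏ j ∈ D.nbrs i, (uVar (CPoly I) - 1) ^ D.m j)
        * (∏ j ∈ D.nbrs i, genSeriesShift (cA j) 1))
      = (D.hNum i).eval₂ HahnSeries.C (uVar D.K) := by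
    rw [hNum, Polynomial.eval₂_mul, mul_assoc, ← Finset.prod_mul_distrib, map_mul, map_prod,
      Polynomial.eval₂_finsetProd]
    congr 1
    · rw [Polynomial.hom_eval₂, Polynomial.eval₂_map, mapLaurent_uVar]
      congr 1
      refine RingHom.ext fun c => ?_
      rw [RingHom.comp_apply, RingHom.comp_apply, RingHom.comp_apply, mapLaurent_C]
      exact congrArg _ (D.evalA.commutes c)
    · refine Finset.prod_congr rfl fun j _ => ?_
      have h2 := uVar_sub_pow_mul_genSeriesShift_revPoly (fun r => D.zK ⟨j, r⟩) 1
      rw [Fintype.card_fin, map_one] at h2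
      simp only [map_mul, map_pow, map_sub, mapLaurent_uVar, mapLaurent_genSeriesShift, hA, map_one]
      rw [h2, Polynomial.eval₂_finsetProd]
      simp
  rw [← hden, ← hnum, ← map_mul, hSeries, mul_assoc, Ring.inverse_mul_cancel _ (D.isUnit_hDenom i),
    mul_one]

/-- The neighbours of `i` are the sources of the arrows into `i` and the targets of those out of
`i`. -/
theorem prod_nbrs (i : I) (g : I → D.K) : ∏ j ∈ D.nbrs i, g j
    = (∏ j ∈ Finset.univ.filter (fun j => D.Arrow j i), g j)
      * ∏ j ∈ Finset.univ.filter (D.Arrow i), g j := by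
  rw [nbrs, Finset.prod_filter, Finset.prod_filter, Finset.prod_filter, ← Finset.prod_mul_distrib]
  refine Finset.prod_congr rfl fun j _ => ?_
  have h1 := (isOrientation_arrow (D := D)).adj_iff i j
  have h2 := (isOrientation_arrow (D := D)).asymm i j
  by_cases h3 : D.Arrow i j <;> by_cases h4 : D.Arrow j i <;> simp_all

theorem shiftK_ptCoef_self {g : ℤ} (hg : g = 1 ∨ g = -1) {dir : I → I → Prop}
    (hdir : ∀ i, ¬ dir i i) (h : ℤ) (v : D.Var) :
    D.shiftK g v (D.ptCoef dir h v)
      = (∏ j ∈ Finset.univ.filter (dir v.1), ∏ s, (D.zK v + 2 * g - D.zK ⟨j, s⟩ + h))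
    / ∏ s ∈ Finset.univ.erase v.2, (D.zK v + 2 * g - D.zK ⟨v.1, s⟩) := by
  rw [ptCoef, map_div₀, map_prod, map_prod]
  congr 1
  · refine Finset.prod_congr rfl fun j hj => ?_
    rw [map_prod]
    refine Finset.prod_congr rfl fun s _ => ?_
    have hvj : (⟨j, s⟩ : D.Var) ≠ v := by
      rintro rfl
      exact hdir _ (Finset.mem_filter.1 hj).2
    rw [map_add, map_sub, shiftK_zK_self hg, shiftK_zK_of_ne hg hvj, map_intCast]
  · refine Finset.prod_congr rfl fun s hs => ?_
    have hvs : (⟨v.1, s⟩ : D.Var) ≠ v := by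
      obtain ⟨i, r⟩ := v
      simpa using Finset.ne_of_mem_erase hs
    rw [map_sub, shiftK_zK_self hg, shiftK_zK_of_ne hg hvs]

theorem prod_erase_inl {α M : Type*} [Fintype α] [DecidableEq α] [CommMonoid M] (f : α ⊕ α → M)
    (r : α) : ∏ k ∈ Finset.univ.erase (Sum.inl r), f k
      = (∏ s ∈ Finset.univ.erase r, f (Sum.inl s)) * ∏ s, f (Sum.inr s) := by
  rw [← Finset.prod_disjSum]
  congr 1
  ext (s | s) <;> simp

theorem prod_erase_inr {α M : Type*} [Fintype α] [DecidableEq α] [CommMonoid M] (f : α ⊕ α → M)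
    (r : α) : ∏ k ∈ Finset.univ.erase (Sum.inr r), f k
      = (∏ s, f (Sum.inl s)) * ∏ s ∈ Finset.univ.erase r, f (Sum.inr s) := by
  rw [← Finset.prod_disjSum]
  congr 1
  ext (s | s) <;> simp

theorem eval_hNum (i : I) (x : D.K) : (D.hNum i).eval x = Polynomial.aeval x (D.pPoly i)
    * ((∏ j ∈ Finset.univ.filter (fun j => D.Arrow j i), ∏ s, (x - (D.zK ⟨j, s⟩ + 1)))
      * ∏ j ∈ Finset.univ.filter (D.Arrow i), ∏ s, (x - (D.zK ⟨j, s⟩ + 1))) := by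
  rw [← prod_nbrs, hNum, Polynomial.eval_mul, Polynomial.eval_map_algebraMap, Polynomial.eval_prod]
  simp [Polynomial.eval_prod]

/-- The first diagonal term of `[E, F]` at `z_{i,r}` is twice the residue of `H_i(u)` there. The
factor `2` comes from the two poles `z_{i,r}` and `z_{i,r} + 2`, whose difference is `-2`. -/
theorem coefE_mul_shiftK_coefF_self (i : I) (r : Fin (D.m i)) :
    D.coefE ⟨i, r⟩ * D.shiftK (-1) ⟨i, r⟩ (D.coefF ⟨i, r⟩)
      = 2 * ((D.hNum i).eval (D.hPole i (Sum.inl r))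
        / ∏ k ∈ Finset.univ.erase (Sum.inl r), (D.hPole i (Sum.inl r) - D.hPole i k)) := by
  rw [prod_erase_inl, ← Finset.mul_prod_erase _ (fun s => _ - D.hPole i (Sum.inr s))
    (Finset.mem_univ r), eval_hNum, coefE, coefF, map_mul, shiftK_ptCoef_self (Or.inr rfl)
    isOrientation_arrow.irrefl, ptCoef, ← Polynomial.aeval_algHom_apply, map_add, map_ofNat,
    shiftK_zK_self (Or.inr rfl)]
  simp only [hPole, Sum.elim_inl, Sum.elim_inr, Int.cast_neg, Int.cast_one, mul_neg, mul_one,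
    neg_add_cancel_right, sub_add_cancel_left]
  rw [Finset.prod_congr rfl (fun j _ => Finset.prod_congr rfl fun s _ =>
      show D.zK ⟨i, r⟩ - D.zK ⟨j, s⟩ + -1 = D.zK ⟨i, r⟩ - (D.zK ⟨j, s⟩ + 1) by ring),
    Finset.prod_congr rfl (fun j _ => Finset.prod_congr rfl fun s _ =>
      show D.zK ⟨i, r⟩ + -2 - D.zK ⟨j, s⟩ + 1 = D.zK ⟨i, r⟩ - (D.zK ⟨j, s⟩ + 1) by ring),
    Finset.prod_congr rfl (fun s _ =>
      show D.zK ⟨i, r⟩ + -2 - D.zK ⟨i, s⟩ = D.zK ⟨i, r⟩ - (D.zK ⟨i, s⟩ + 2) by ring)]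
  field_simp

/-- The second diagonal term of `[E, F]` is minus twice the residue of `H_i(u)` at `z_{i,r} + 2`. -/
theorem coefF_mul_shiftK_coefE_self (i : I) (r : Fin (D.m i)) :
    D.coefF ⟨i, r⟩ * D.shiftK 1 ⟨i, r⟩ (D.coefE ⟨i, r⟩)
      = -2 * ((D.hNum i).eval (D.hPole i (Sum.inr r))
        / ∏ k ∈ Finset.univ.erase (Sum.inr r), (D.hPole i (Sum.inr r) - D.hPole i k)) := by
  rw [prod_erase_inr, ← Finset.mul_prod_erase _ (fun s => _ - D.hPole i (Sum.inl s))
    (Finset.mem_univ r), eval_hNum, coefE, coefF, map_mul, shiftK_ptCoef_self (Or.inl rfl)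
    (dir := fun i j => D.Arrow j i) isOrientation_arrow.swap.irrefl, ptCoef, map_neg, map_one]
  simp only [hPole, Sum.elim_inl, Sum.elim_inr, Int.cast_neg, Int.cast_one, mul_one,
    add_sub_cancel_left, add_sub_add_right_eq_sub]
  rw [Finset.prod_congr rfl (fun j _ => Finset.prod_congr rfl fun s _ =>
      show D.zK ⟨i, r⟩ - D.zK ⟨j, s⟩ + 1 = D.zK ⟨i, r⟩ + 2 - (D.zK ⟨j, s⟩ + 1) by ring),
    Finset.prod_congr rfl (fun j _ => Finset.prod_congr rfl fun s _ =>
      show D.zK ⟨i, r⟩ + 2 - D.zK ⟨j, s⟩ + -1 = D.zK ⟨i, r⟩ + 2 - (D.zK ⟨j, s⟩ + 1) by ring)]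
  field_simp

/-- `[E_i^{(p+1)}, F_i^{(q+1)}]` is multiplication by twice the coefficient of `u^{-(p+q+1)}` in the
image of `H_i(u)`: the diagonal terms are the residues of `2 u^{p+q} H_i(u)` at `z_{i,r}` and
`z_{i,r} + 2`. -/
theorem opE_opF_eq_mulLeft (i : I) (p q : ℕ) :
    ⁅D.opE i p, D.opF i q⁆
      = LinearMap.mulLeft ℂ (2 * D.evalA ((D.hSeries i).coeff ((p + q : ℕ) + 1))) := by
  rw [opE_opF]
  congr 1
  have h := coeff_of_mul_prod_eq (hPole_injective i) (D.hNum i) _ (mapLaurent_hSeries_mul i) (p + q)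
  rw [mapLaurent_coeff] at h
  refine Eq.trans ?_ (congrArg (2 * ·) h.symm)
  simp only [coefE_mul_shiftK_coefF_self, coefF_mul_shiftK_coefE_self, Fintype.sum_sum_type,
    mul_add, Finset.mul_sum, sub_eq_add_neg, neg_mul, neg_neg]
  simp only [Finset.sum_add_distrib, mul_assoc]
  rfl

/-! ### The representation of the free algebra -/

variable (D)

/-- The action of the generators on rational functions, extended to the free algebra. -/
def freeRep : Free I →ₐ[ℂ] Module.End ℂ D.K :=
  FreeAlgebra.lift ℂ fun g => match g with
    | Gen.A i q => LinearMap.mulLeft ℂ (D.coefA i q)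
    | Gen.E i q => D.opE i q.natPred
    | Gen.F i q => D.opF i q.natPred

variable {D}

theorem freeRep_genA (i : I) (p : ℕ) :
    D.freeRep (genA i p) = LinearMap.mulLeft ℂ (D.coefA i p) := by
  rw [genA]
  split_ifs with h
  · simp [freeRep]
  · obtain rfl : p = 0 := by omega
    rw [map_one, coefA_zero, LinearMap.mulLeft_one]
    rfl

theorem freeRep_genE (i : I) (q : ℕ+) : D.freeRep (genE i q) = D.opE i q.natPred := by
  simp [freeRep, genE]

theorem freeRep_genF (i : I) (q : ℕ+) : D.freeRep (genF i q) = D.opF i q.natPred := by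
  simp [freeRep, genF]

/-- The images of the `A_i^{(q)}` commute, so the order chosen by `ofCPoly` is immaterial. -/
theorem freeRep_ofCPoly (f : CPoly I) :
    D.freeRep (ofCPoly f) = LinearMap.mulLeft ℂ (D.evalA f) := by
  have : D.freeRep.toLinearMap ∘ₗ ofCPoly
      = (Algebra.lmul ℂ D.K).toLinearMap ∘ₗ D.evalA.toLinearMap := by
    refine (MvPolynomial.basisMonomials (I × ℕ+) ℂ).ext fun d => ?_
    rw [LinearMap.comp_apply, LinearMap.comp_apply, ofCPoly, Module.Basis.constr_basis,
      MvPolynomial.coe_basisMonomials, AlgHom.toLinearMap_apply, AlgHom.toLinearMap_apply,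
      AlgHom.toLinearMap_apply, map_list_prod, List.map_map, evalA, MvPolynomial.aeval_monomial,
      map_one, one_mul]
    have h1 : (D.freeRep ∘ fun v : I × ℕ+ => FreeAlgebra.ι ℂ (Gen.A v.1 v.2))
        = Algebra.lmul ℂ D.K ∘ fun v => D.coefA v.1 v.2 := by
      funext v
      simp only [freeRep, Function.comp_apply, FreeAlgebra.lift_ι_apply]
      rfl
    have h2 : d.prod (fun v k => D.coefA v.1 v.2 ^ k)
        = ((Finsupp.toMultiset d).map fun v => D.coefA v.1 v.2).prod := by
      rw [Finsupp.toMultiset_map, Finsupp.prod_toMultiset, Finsupp.prod_mapDomain_index pow_zero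
        (fun _ _ _ => pow_add _ _ _)]
    rw [h1, ← List.map_map, ← map_list_prod, h2, ← Multiset.prod_coe, ← Multiset.map_coe,
      Multiset.coe_toList]
  exact LinearMap.congr_fun this f

theorem map_bracket {A B : Type*} [Ring A] [Ring B] [Algebra ℂ A] [Algebra ℂ B] (φ : A →ₐ[ℂ] B)
    (x y : A) : φ ⁅x, y⁆ = ⁅φ x, φ y⁆ := by
  simp [Ring.lie_def]

theorem natPred_add_one (q : ℕ+) : (q + 1).natPred = q.natPred + 1 := by
  have := q.pos
  simp only [PNat.natPred, PNat.add_coe, PNat.one_coe]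
  omega

/-- The difference operators satisfy the defining relations of the shifted Yangian, already on all
rational functions. -/
theorem freeRep_eq_of_rel {x y : Free I} (h : D.Rel x y) : D.freeRep x = D.freeRep y := by
  have hser (i j : I) (hij : i ≠ j) {N : ℕ} (hN : N = (1 - dot D.graph i j).toNat) :
      (¬ D.graph.Adj i j ∧ N = 1) ∨ (D.graph.Adj i j ∧ N = 2) := by
    by_cases h : D.graph.Adj i j
    · exact Or.inr ⟨h, by simp [hN, dot, hij, h]⟩
    · exact Or.inl ⟨h, by simp [hN, dot, hij, h]⟩
  induction h with
  | AA i j p q =>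
    rw [map_bracket, map_zero, freeRep_genA, freeRep_genA, Ring.lie_def,
      Module.End.mul_eq_comp, Module.End.mul_eq_comp, ← LinearMap.mulLeft_mul,
      ← LinearMap.mulLeft_mul, mul_comm, sub_self]
  | EF i j p q =>
    rw [map_bracket, freeRep_genE, freeRep_genF]
    split_ifs with hij
    · subst hij
      have hpq : ((p : ℤ) + q - 1) = ((p.natPred + q.natPred : ℕ) : ℤ) + 1 := by
        have h1 := p.natPred_add_one
        have h2 := q.natPred_add_one
        omega
      rw [opE_opF_eq_mulLeft, map_mul, map_ofNat, genH, freeRep_ofCPoly, hpq, two_mul, two_mul]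
      ext f
      simp [add_mul]
    · rw [opE_opF_of_ne hij, map_zero]
  | AE i j p q =>
    rw [map_sub, map_bracket, map_bracket, freeRep_genA, freeRep_genA, freeRep_genE, freeRep_genE,
      natPred_add_one, opE_coefA, apply_ite D.freeRep]
    simp only [map_neg, map_mul, map_ofNat, map_zero, freeRep_genA, freeRep_genE]
  | AF i j p q =>
    rw [map_sub, map_bracket, map_bracket, freeRep_genA, freeRep_genA, freeRep_genF, freeRep_genF,
      natPred_add_one, opF_coefA, apply_ite D.freeRep]
    simp only [map_mul, map_ofNat, map_zero, freeRep_genA, freeRep_genF]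
  | EE i j p q =>
    have := D.shiftFamily_coefE.shiftSum_exchange i j p.natPred q.natPred
    rw [neg_mul, one_mul, neg_smul, neg_neg] at this
    simp only [map_sub, map_bracket, freeRep_genE, natPred_add_one, map_zsmul, map_add, map_mul]
    exact this
  | FF i j p q =>
    have := D.shiftFamily_coefF.shiftSum_exchange i j p.natPred q.natPred
    rw [one_mul] at this
    simp only [map_sub, map_bracket, freeRep_genF, natPred_add_one, map_zsmul, map_add, map_mul,
      map_neg]
    exact this
  | serreE i j hij p q =>
    rcases hser i j hij rfl with ⟨hadj, hN⟩ | ⟨hadj, hN⟩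
    · obtain ⟨a, ha⟩ := symBracket_of_eq_one (genE i) (genE j q) hN p
      rw [ha, map_bracket, map_zero, freeRep_genE, freeRep_genE]
      exact D.shiftFamily_coefE.shiftSum_commute hij hadj _ _
    · obtain ⟨a, b, hab⟩ := symBracket_of_eq_two (genE i) (genE j q) hN p
      simp only [hab, map_add, map_bracket, map_zero, freeRep_genE]
      exact D.shiftFamily_coefE.shiftSum_serre hadj _ _ _
  | serreF i j hij p q =>
    rcases hser i j hij rfl with ⟨hadj, hN⟩ | ⟨hadj, hN⟩
    · obtain ⟨a, ha⟩ := symBracket_of_eq_one (genF i) (genF j q) hN p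
      rw [ha, map_bracket, map_zero, freeRep_genF, freeRep_genF]
      exact D.shiftFamily_coefF.shiftSum_commute hij hadj _ _
    · obtain ⟨a, b, hab⟩ := symBracket_of_eq_two (genF i) (genF j q) hN p
      simp only [hab, map_add, map_bracket, map_zero, freeRep_genF]
      exact D.shiftFamily_coefF.shiftSum_serre hadj _ _ _

end Datum

/-! ### The action on symmetric polynomials -/

namespace Datum

variable {I : Type*} [Fintype I] (D : Datum I)

/-- The action of `Σ = ∏ᵢ Σ_{mᵢ}` on rational functions. -/
def permK (s : (i : I) → Equiv.Perm (Fin (D.m i))) : D.K ≃ₐ[ℂ] D.K :=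
  fracEquiv (MvPolynomial.renameEquiv ℂ (Equiv.sigmaCongrRight s))

/-- The inclusion of `P^Σ` in the field of fractions of `P`. -/
def symIncl : D.PSym →ₗ[ℂ] D.K :=
  (IsScalarTower.toAlgHom ℂ D.P D.K).toLinearMap ∘ₗ D.PSym.val.toLinearMap

variable {D}

theorem symIncl_apply (f : D.PSym) : D.symIncl f = algebraMap D.P D.K f := rfl

theorem symIncl_injective : Function.Injective D.symIncl := fun _ _ h =>
  Subtype.ext (IsFractionRing.injective D.P D.K h)

theorem mem_PSym_iff {f : D.P} : f ∈ D.PSym ↔ ∀ s : (i : I) → Equiv.Perm (Fin (D.m i)),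
    MvPolynomial.rename (Equiv.sigmaCongrRight s) f = f := by
  simp [PSym, Algebra.mem_iInf]

theorem permK_symIncl (s : (i : I) → Equiv.Perm (Fin (D.m i))) (f : D.PSym) :
    D.permK s (D.symIncl f) = D.symIncl f := by
  rw [symIncl_apply, permK, fracEquiv_algebraMap]
  exact congrArg _ (mem_PSym_iff.1 f.2 s)

/-- A polynomial that `Σ` fixes within the field of fractions lies in `P^Σ`. -/
theorem exists_symIncl_eq {x : D.K} (hx : x ∈ (algebraMap D.P D.K).range)
    (hs : ∀ s, D.permK s x = x) : ∃ f, D.symIncl f = x := by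
  obtain ⟨f, rfl⟩ := hx
  refine ⟨⟨f, mem_PSym_iff.2 fun s => IsFractionRing.injective D.P D.K ?_⟩, rfl⟩
  rw [← hs s, permK, fracEquiv_algebraMap]
  rfl

theorem permK_zK (s : (i : I) → Equiv.Perm (Fin (D.m i))) (i : I) (r : Fin (D.m i)) :
    D.permK s (D.zK ⟨i, r⟩) = D.zK ⟨i, s i r⟩ := by
  rw [zK, permK, fracEquiv_algebraMap]
  simp [zK]

theorem permK_shiftK (s : (i : I) → Equiv.Perm (Fin (D.m i))) (h : ℤ) (i : I) (r : Fin (D.m i))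
    (f : D.K) : D.permK s (D.shiftK h ⟨i, r⟩ f) = D.shiftK h ⟨i, s i r⟩ (D.permK s f) := by
  refine fracEquiv_comm (fun f => ?_) f
  split_ifs
  · exact renameEquiv_beta _ _ f
  · exact renameEquiv_beta_symm _ _ f

theorem sigmaCongrRight_mulSingle_swap (i : I) (a b : Fin (D.m i)) :
    Equiv.sigmaCongrRight (Pi.mulSingle (M := fun i => Equiv.Perm (Fin (D.m i))) i (Equiv.swap a b))
      = Equiv.swap (⟨i, a⟩ : D.Var) ⟨i, b⟩ := by
  refine Equiv.ext fun ⟨j, r⟩ => ?_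
  by_cases hj : j = i
  · subst hj
    simp only [Equiv.sigmaCongrRight_apply, Pi.mulSingle_eq_same, Equiv.swap_apply_def,
      Sigma.mk.injEq, heq_eq_eq, true_and]
    split_ifs <;> rfl
  · rw [Equiv.swap_apply_of_ne_of_ne]
    · simp [hj]
    · exact fun h => hj (congrArg Sigma.fst h)
    · exact fun h => hj (congrArg Sigma.fst h)

theorem zK_mem_range (v : D.Var) : D.zK v ∈ (algebraMap D.P D.K).range := ⟨_, rfl⟩

theorem shiftK_symIncl_mem_range (h : ℤ) (v : D.Var) (f : D.PSym) :
    D.shiftK h v (D.symIncl f) ∈ (algebraMap D.P D.K).range := by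
  rw [symIncl_apply, shiftK, fracEquiv_algebraMap]
  exact ⟨_, rfl⟩

/-- The difference operators `∑_r c_{i,r} ptCoef_{i,r} σ_{i,r}` with polynomial, `Σ`-equivariant `c`
preserve `P^Σ`: the value is a Lagrange sum of a family that `Σ` permutes, hence invariant, and it
is a polynomial since divided differences of polynomials are. -/
theorem exists_symIncl_eq_sum (dir : I → I → Prop) (h h' : ℤ) (c : D.Var → D.K)
    (hc : ∀ v, c v ∈ (algebraMap D.P D.K).range)
    (hcs : ∀ s i r, D.permK s (c ⟨i, r⟩) = c ⟨i, s i r⟩) (i : I) (f : D.PSym) :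
    ∃ g, D.symIncl g = ∑ r : Fin (D.m i),
      c ⟨i, r⟩ * D.ptCoef dir h ⟨i, r⟩ * D.shiftK h' ⟨i, r⟩ (D.symIncl f) := by
  set g : Fin (D.m i) → D.K := fun r => c ⟨i, r⟩
    * (∏ j ∈ Finset.univ.filter (dir i), ∏ s, (D.zK ⟨i, r⟩ - D.zK ⟨j, s⟩ + h))
    * D.shiftK h' ⟨i, r⟩ (D.symIncl f) with hg
  have hsum : ∑ r : Fin (D.m i),
      c ⟨i, r⟩ * D.ptCoef dir h ⟨i, r⟩ * D.shiftK h' ⟨i, r⟩ (D.symIncl f)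
      = lagrangeSum (fun r => D.zK ⟨i, r⟩) g Finset.univ := by
    refine Finset.sum_congr rfl fun r _ => ?_
    rw [ptCoef, hg]
    ring
  have hz (s) (r : Fin (D.m i)) : D.permK s (D.zK ⟨i, r⟩) = D.zK ⟨i, s i r⟩ := permK_zK s i r
  have hgs (s) (r : Fin (D.m i)) : D.permK s (g r) = g (s i r) := by
    simp only [hg, map_mul, map_prod, map_add, map_sub, map_intCast, permK_zK, hcs, permK_shiftK,
      permK_symIncl]
    congr 2
    refine Finset.prod_congr rfl fun j _ => ?_
    exact Equiv.prod_comp (s j) fun t => D.zK ⟨i, s i r⟩ - D.zK ⟨j, t⟩ + (h : D.K)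
  rw [hsum]
  refine exists_symIncl_eq ?_ fun s => ?_
  · refine lagrangeSum_mem (zK_injective.comp sigma_mk_injective)
      (fun a b => (D.permK (Pi.mulSingle i (Equiv.swap a b)) : D.K →+* D.K)) (fun a b r => ?_)
      (fun a b r => ?_) _ (fun a b x hx => ?_) fun r => ?_
    · exact (hz _ r).trans (by rw [Pi.mulSingle_eq_same]; rfl)
    · exact (hgs _ r).trans (by rw [Pi.mulSingle_eq_same])
    · have := divDiff_mem_range (a := (⟨i, a⟩ : D.Var)) (b := ⟨i, b⟩) x hx
      rw [← sigmaCongrRight_mulSingle_swap] at this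
      exact this
    · refine mul_mem (mul_mem (hc _) (prod_mem fun j _ => prod_mem fun s _ => ?_))
        (shiftK_symIncl_mem_range _ _ _)
      exact add_mem (sub_mem (zK_mem_range _) (zK_mem_range _)) (intCast_mem _ _)
  · refine (map_lagrangeSum (D.permK s : D.K →+* D.K) (s i) (hz s) (hgs s) _).trans ?_
    simp

theorem exists_symIncl_opE (i : I) (p : ℕ) (f : D.PSym) :
    ∃ g, D.symIncl g = D.opE i p (D.symIncl f) := by
  obtain ⟨g, hg⟩ := exists_symIncl_eq_sum (fun i j => D.Arrow j i) (-1) (-1)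
    (fun v => -D.zK v ^ p) (fun v => neg_mem (pow_mem (zK_mem_range v) _))
    (fun s i r => by rw [map_neg, map_pow, permK_zK]) i f
  refine ⟨g, hg.trans ?_⟩
  simp only [opE, shiftSum, LinearMap.sum_apply, shiftTerm_apply, coefE]
  exact Finset.sum_congr rfl fun r _ => by ring

theorem exists_symIncl_opF (i : I) (p : ℕ) (f : D.PSym) :
    ∃ g, D.symIncl g = D.opF i p (D.symIncl f) := by
  have hc (v : D.Var) : Polynomial.aeval (D.zK v + 2) (D.pPoly v.1) * (D.zK v + 2) ^ p
      ∈ (algebraMap D.P D.K).range := by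
    have h2 : D.zK v + 2 = algebraMap D.P D.K (MvPolynomial.X v + 2) := by
      rw [map_add, map_ofNat, zK]
    rw [h2, Polynomial.aeval_algebraMap_apply]
    exact mul_mem (RingHom.mem_range_self _ _) (pow_mem (RingHom.mem_range_self _ _) _)
  obtain ⟨g, hg⟩ := exists_symIncl_eq_sum D.Arrow 1 1 _ hc
    (fun s i r => by
      rw [map_mul, map_pow, ← Polynomial.aeval_algHom_apply, map_add, map_ofNat, permK_zK]) i f
  refine ⟨g, hg.trans ?_⟩
  simp only [opF, shiftSum, LinearMap.sum_apply, shiftTerm_apply, coefF]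
  exact Finset.sum_congr rfl fun r _ => by ring

theorem exists_symIncl_coefA (i : I) (p : ℕ) (f : D.PSym) :
    ∃ g, D.symIncl g = D.coefA i p * D.symIncl f := by
  refine exists_symIncl_eq (mul_mem ?_ ⟨_, rfl⟩) fun s => ?_
  · exact ⟨(revPoly fun r => D.z i r).coeff p, map_coeff_revPoly _ _ _⟩
  · rw [map_mul, permK_symIncl]
    congr 1
    refine (map_coeff_revPoly (D.permK s : D.K →+* D.K) _ p).trans ?_
    rw [coefA]
    congr 1
    exact (Finset.prod_congr rfl fun r _ => by
      rw [RingHom.coe_coe]; exact congrArg _ (congrArg (Polynomial.C · * _) (permK_zK s i r))).trans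
      (Equiv.prod_comp (s i) fun r => 1 - Polynomial.C (D.zK ⟨i, r⟩) * Polynomial.X)

/-- An operator that preserves the image of an injective map restricts to the source. -/
theorem exists_end_intertwining {k M N : Type*} [CommRing k] [AddCommGroup M] [AddCommGroup N]
    [Module k M] [Module k N] {e : M →ₗ[k] N} (he : Function.Injective e) (T : Module.End k N)
    (hT : ∀ f, ∃ g, e g = T (e f)) : ∃ t : Module.End k M, ∀ f, e (t f) = T (e f) := by
  choose g hg using hT
  exact ⟨⟨⟨g, fun x y => he (by simp [hg])⟩, fun c x => he (by simp [hg])⟩, hg⟩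

theorem exists_gen_intertwining (x : Gen I) : ∃ t : Module.End ℂ D.PSym,
    ∀ f, D.symIncl (t f) = D.freeRep (FreeAlgebra.ι ℂ x) (D.symIncl f) := by
  refine exists_end_intertwining symIncl_injective _ fun f => ?_
  cases x with
  | A i q => simpa [freeRep] using exists_symIncl_coefA i q f
  | E i q => simpa [freeRep] using exists_symIncl_opE i q.natPred f
  | F i q => simpa [freeRep] using exists_symIncl_opF i q.natPred f

variable (D)

/-- The action of the free algebra on symmetric polynomials, restricted from `freeRep`. -/
def freeSymRep : Free I →ₐ[ℂ] Module.End ℂ D.PSym :=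
  FreeAlgebra.lift ℂ fun x => (exists_gen_intertwining x).choose

variable {D}

theorem symIncl_freeSymRep (x : Free I) (f : D.PSym) :
    D.symIncl (D.freeSymRep x f) = D.freeRep x (D.symIncl f) := by
  induction x using FreeAlgebra.induction generalizing f with
  | grade0 c => simp [AlgHom.commutes, Module.algebraMap_end_apply]
  | grade1 x =>
    rw [freeSymRep, FreeAlgebra.lift_ι_apply]
    exact (exists_gen_intertwining x).choose_spec f
  | mul x y hx hy => simp [hx, hy]
  | add x y hx hy => simp [hx, hy]

variable (D)

/-- The action of `Y_μ` on `P^Σ`. -/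
def symRep : D.Y →ₐ[ℂ] Module.End ℂ D.PSym :=
  RingQuot.liftAlgHom ℂ ⟨D.freeSymRep, fun x y hxy => LinearMap.ext fun f => symIncl_injective (by
    rw [symIncl_freeSymRep, symIncl_freeSymRep, freeRep_eq_of_rel hxy])⟩

variable {D}

theorem symIncl_symRep_mk (x : Free I) (f : D.PSym) :
    D.symIncl (D.symRep (RingQuot.mkAlgHom ℂ D.Rel x) f) = D.freeRep x (D.symIncl f) := by
  rw [symRep, RingQuot.liftAlgHom_mkAlgHom_apply, symIncl_freeSymRep]

/-! ### Comparison with the generating series -/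

theorem symSeries_eq (g : ℕ → D.PSym) : D.symSeries g = genSeries fun p => D.symIncl (g p) := rfl

theorem symSeriesPos_eq (g : ℕ+ → D.PSym) (a : ℕ → D.K)
    (h : ∀ q : ℕ+, D.symIncl (g q) = a q.natPred) :
    D.symSeriesPos g = genSeries fun n => if n = 0 then 0 else a (n - 1) := by
  rw [symSeriesPos, symSeries_eq]
  congr 1
  funext n
  cases n with
  | zero => simp
  | succ n => simpa using h ⟨n + 1, n.succ_pos⟩

theorem rhsA_eq (i : I) (f : D.PSym) :
    D.rhsA i f = genSeries fun p => D.coefA i p * D.symIncl f := by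
  rw [← genSeries_mul_C]
  have h := uVar_pow_mul_genSeries_revPoly fun r => D.zK ⟨i, r⟩
  have hW : (D.W i).eval₂ D.ofP (uVar D.K) = ∏ r, (uVar D.K - HahnSeries.C (D.zK ⟨i, r⟩)) := by
    rw [W, Polynomial.eval₂_finsetProd]
    refine Finset.prod_congr rfl fun r _ => ?_
    rw [Polynomial.eval₂_sub, Polynomial.eval₂_X, Polynomial.eval₂_C]
    rfl
  have hu : uVar (FractionRing D.P) ^ (-(D.m i : ℤ)) * uVar D.K ^ D.m i = 1 :=
    uVar_zpow_neg_mul_pow (D.m i)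
  rw [rhsA, hW, ← h, Fintype.card_fin, ← mul_assoc, hu, one_mul]
  rfl

/-- The generating series of `∑_r a_r x_r^p σ_r` is `∑_r a_r (u - x_r)⁻¹ σ_r`. -/
theorem series_eq_sum (a x : D.Var → D.K) (σ : D.Var → D.K ≃ₐ[ℂ] D.K) (i : I) (f : D.K) :
    (genSeries fun n => if n = 0 then 0 else D.shiftSum a x σ i (n - 1) f)
      = ∑ r : Fin (D.m i), (uVar D.K - HahnSeries.C (x ⟨i, r⟩))⁻¹
        * HahnSeries.C (a ⟨i, r⟩ * σ ⟨i, r⟩ f) := by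
  simp only [inv_uVar_sub_C, genSeries_mul_C, genSeries_sum]
  congr 1
  funext n
  split_ifs
  · simp
  · simp only [shiftSum, LinearMap.sum_apply, shiftTerm_apply]
    exact Finset.sum_congr rfl fun r _ => by ring

theorem algebraMap_prod_eval_W (S : Finset I) (x : D.P) (y : D.K) (h : ℤ)
    (hxy : algebraMap D.P D.K x = y + h) :
    algebraMap D.P D.K (∏ j ∈ S, (D.W j).eval x) = ∏ j ∈ S, ∏ s, (y - D.zK ⟨j, s⟩ + h) := by
  rw [map_prod]
  refine Finset.prod_congr rfl fun j _ => ?_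
  rw [W, Polynomial.eval_prod, map_prod]
  refine Finset.prod_congr rfl fun s _ => ?_
  rw [Polynomial.eval_sub, Polynomial.eval_X, Polynomial.eval_C, map_sub, hxy,
    show algebraMap D.P D.K (D.z j s) = D.zK ⟨j, s⟩ from rfl]
  ring

theorem algebraMap_eval_Wr (i : I) (r : Fin (D.m i)) :
    algebraMap D.P D.K ((D.Wr i r).eval (D.z i r))
      = ∏ s ∈ Finset.univ.erase r, (D.zK ⟨i, r⟩ - D.zK ⟨i, s⟩) := by
  rw [Wr, Polynomial.eval_prod, map_prod]
  refine Finset.prod_congr rfl fun s _ => ?_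
  rw [Polynomial.eval_sub, Polynomial.eval_X, Polynomial.eval_C, map_sub]
  rfl

theorem rhsE_eq (i : I) (f : D.PSym) :
    D.rhsE i f = genSeries fun n => if n = 0 then 0 else D.opE i (n - 1) (D.symIncl f) := by
  refine Eq.trans ?_ (series_eq_sum D.coefE D.zK (D.shiftK (-1)) i (D.symIncl f)).symm
  rw [rhsE, ← Finset.sum_neg_distrib]
  refine Finset.sum_congr rfl fun r _ => ?_
  refine (congrArg Neg.neg (C_div_mul_C _ _ _ (D.zK ⟨i, r⟩))).trans ?_
  rw [← mul_neg, ← map_neg, coefE, ptCoef, symIncl_apply, shiftK, fracEquiv_algebraMap,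
    if_neg (by norm_num), algebraMap_eval_Wr, algebraMap_prod_eval_W _ _ (D.zK ⟨i, r⟩) (-1)]
  · congr 2
    ring
  · rw [map_sub, map_one, Int.cast_neg, Int.cast_one, ← sub_eq_add_neg]
    rfl

theorem rhsF_eq (i : I) (f : D.PSym) :
    D.rhsF i f = genSeries fun n => if n = 0 then 0 else D.opF i (n - 1) (D.symIncl f) := by
  refine Eq.trans ?_
    (series_eq_sum D.coefF (fun v => D.zK v + 2) (D.shiftK 1) i (D.symIncl f)).symm
  have h2 (r : Fin (D.m i)) : uVar (FractionRing D.P) - D.ofP (D.z i r) - 2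
      = uVar D.K - HahnSeries.C (D.zK ⟨i, r⟩ + 2) := by
    rw [map_add, map_ofNat, ← sub_sub]
    rfl
  have h2' (r : Fin (D.m i)) : algebraMap D.P (FractionRing D.P) (D.z i r + 2)
      = D.zK ⟨i, r⟩ + 2 := by
    rw [map_add, map_ofNat]
    rfl
  rw [rhsF]
  refine Finset.sum_congr rfl fun r _ => ?_
  rw [h2]
  refine (C_div_mul_C _ _ _ (D.zK ⟨i, r⟩ + 2)).trans ?_
  rw [coefF, ptCoef, symIncl_apply, shiftK, fracEquiv_algebraMap,
    if_pos rfl, algebraMap_eval_Wr, map_mul (algebraMap D.P (FractionRing D.P)),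
    algebraMap_prod_eval_W _ _ (D.zK ⟨i, r⟩) 1, ← Polynomial.aeval_algebraMap_apply, h2']
  · rw [mul_div_assoc]
  · rw [map_add, map_one, Int.cast_one]
    rfl

theorem symRep_spec (i : I) (f : D.PSym) :
    D.symSeries (fun p => D.symRep (D.A i p) f) = D.rhsA i f ∧
      D.symSeriesPos (fun q => D.symRep (D.E i q) f) = D.rhsE i f ∧
      D.symSeriesPos (fun q => D.symRep (D.F i q) f) = D.rhsF i f := by
  refine ⟨?_, ?_, ?_⟩
  · rw [symSeries_eq, rhsA_eq]
    congr 1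
    funext p
    rw [A, symIncl_symRep_mk, freeRep_genA, LinearMap.mulLeft_apply]
  · rw [rhsE_eq]
    refine symSeriesPos_eq _ (fun n => D.opE i n (D.symIncl f)) fun q => ?_
    rw [E, symIncl_symRep_mk, freeRep_genE]
  · rw [rhsF_eq]
    refine symSeriesPos_eq _ (fun n => D.opF i n (D.symIncl f)) fun q => ?_
    rw [F, symIncl_symRep_mk, freeRep_genF]

theorem symSeries_injective : Function.Injective D.symSeries := fun g g' h => by
  funext p
  exact symIncl_injective (congrFun (genSeries_injective h) p)

theorem symSeriesPos_injective : Function.Injective D.symSeriesPos := fun g g' h => by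
  funext q
  have h' := congrFun (symSeries_injective h) q
  simp only [q.pos, dif_pos] at h'
  exact h'

/-- The series determine the images of the generators, hence the homomorphism. -/
theorem algHom_ext_of_series {ρ ρ' : D.Y →ₐ[ℂ] Module.End ℂ D.PSym}
    (hA : ∀ i f, D.symSeries (fun p => ρ (D.A i p) f) = D.symSeries (fun p => ρ' (D.A i p) f))
    (hE : ∀ i f, D.symSeriesPos (fun q => ρ (D.E i q) f) = D.symSeriesPos fun q => ρ' (D.E i q) f)
    (hF : ∀ i f, D.symSeriesPos (fun q => ρ (D.F i q) f) = D.symSeriesPos fun q => ρ' (D.F i q) f) :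
    ρ = ρ' := by
  refine RingQuot.ringQuot_ext' ℂ _ _ (FreeAlgebra.hom_ext (funext fun x => ?_))
  refine LinearMap.ext fun f => ?_
  cases x with
  | A i q =>
    have h := congrFun (symSeries_injective (hA i f)) q
    simp only [A, genA, q.pos, dif_pos] at h
    exact h
  | E i q => exact congrFun (symSeriesPos_injective (hE i f)) q
  | F i q => exact congrFun (symSeriesPos_injective (hF i f)) q

end Datum

end ShiftedYangian

end

theorem mainTheorem8 :
    (∀ {I : Type*} [Fintype I] (D : ShiftedYangian.Datum I),
      ∃! ρ : D.Y →ₐ[ℂ] Module.End ℂ D.PSym,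
        ∀ (i : I) (f : D.PSym),
          D.symSeries (fun p => ρ (D.A i p) f) = D.rhsA i f ∧
          D.symSeriesPos (fun q => ρ (D.E i q) f) = D.rhsE i f ∧
          D.symSeriesPos (fun q => ρ (D.F i q) f) = D.rhsF i f) ∧
    (∀ (S : Type*) [CommRing S] [IsDomain S] [Algebra ℂ S] (n : ℕ) (c : Polynomial S),
      (∀ f : ShiftedYangian.RatFun S (n + 1),
        (∀ s : Equiv.Perm (Fin (n + 1)), ShiftedYangian.ratPerm S s f = f) →
          ShiftedYangian.symShiftOp S c f = ShiftedYangian.divDiffOp S c f) ∧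
      (∀ f : MvPolynomial (Fin (n + 1)) S, f.IsSymmetric →
        ∃ g : MvPolynomial (Fin (n + 1)) S, g.IsSymmetric ∧
          ShiftedYangian.symShiftOp S c (algebraMap _ (ShiftedYangian.RatFun S (n + 1)) f)
            = algebraMap _ (ShiftedYangian.RatFun S (n + 1)) g ∧
          ShiftedYangian.divDiffOp S c (algebraMap _ (ShiftedYangian.RatFun S (n + 1)) f)
            = algebraMap _ (ShiftedYangian.RatFun S (n + 1)) g)) := by
  refine ⟨fun D => ⟨D.symRep, fun i f => ShiftedYangian.Datum.symRep_spec i f, fun ρ hρ => ?_⟩,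
    fun S _ _ _ n c => ⟨fun f hf => ShiftedYangian.symShiftOp_eq_divDiffOp c hf,
      fun f hf => ShiftedYangian.exists_symmetric_symShiftOp c hf⟩⟩
  have h := fun i f => ShiftedYangian.Datum.symRep_spec (D := D) i f
  exact ShiftedYangian.Datum.algHom_ext_of_series
    (fun i f => (hρ i f).1.trans (h i f).1.symm)
    (fun i f => (hρ i f).2.1.trans (h i f).2.1.symm)
    (fun i f => (hρ i f).2.2.trans (h i f).2.2.symm)
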